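/- For $A\in\mathbb{R}^{l\times d}$ and $b\in\mathbb{R}^l$ let $W=\{x\in\mathbb{R}^d \mid Ax<b\}$ (componentwise strict inequalities), and for $P\subset\mathbb{R}^d$ put $$\operatorname{Sep}_W(P)=\{P\cap(t+W)\mid t\in\mathbb{R}^d\}.$$ \textbf{Model.} A real RAM is a program over storage cells (directly addressed registers and indirectly addressed memory banks) each holding one real number, built from assignments of integer constants, copying, the operations $+,-,\cdot,/$, reading and writing of memory at a computed natural-number address, comparisons ($<,\le,=$), branching and loops; each arithmetic operation, assignment, memory access and comparison costs one unit, and there is no rounding operation. The input consists of $l$, $q$, the entries of $A$ and $b$, and the coordinates of an enumeration $p_1,\dots,p_q$ of a finite set $P$ with $q$ points; the output is a list (repetitions allowed) of $0$-$1$ incidence vectors of subsets of $P$. \textbf{Theorem.} For every fixed dimension $d\ge 1$ there is a real RAM program that, for all $l$, $A$, $b$ and all finite sets $P=\{p_1,\dots,p_q\}\subset\mathbb{R}^d$ with $q$ points, halts with a list whose members are exactly the members of $\operatorname{Sep}_W(P)$, after $O((lq)^{d+1})$ operations, where the constant in $O(\cdot)$ depends only on $d$ (a factor $l=0$ or $q=0$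 being replaced by $1$). Hence, for each fixed $W=\{x\mid Ax<b\}$, it computes $\operatorname{Sep}_W(P)$ with $O(\operatorname{card}(P)^{d+1})$ operations, the constant depending on $W$ (through $d,A,b$) only. Likewise, for each fixed $W=\{x\mid Ax\le b\}$ given as an intersection of finitely many halfspaces (all rows of $A$ nonzero), it computes $\operatorname{Sep}_{W^\circ}(P)$ for the interior $W^\circ$ of $W$ with $O(\operatorname{card}(P)^{d+1})$ operations. -/

import Mathlib

/-! ## The separation problem -/

/-- `S_{W,t}(P) = P ∩ (t + W)`. -/
def sepPart {d : ℕ} (W P : Set (Fin d → ℝ)) (t : Fin d → ℝ) : Set (Fin d → ℝ) :=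
  P ∩ (fun x => t + x) '' W

/-- `Sep_W(P) = {S_{W,t}(P) | t ∈ ℝ^d}`. -/
def SepFamily {d : ℕ} (W P : Set (Fin d → ℝ)) : Set (Set (Fin d → ℝ)) :=
  {S | ∃ t : Fin d → ℝ, S = sepPart W P t}

/-- The open polyhedron `{x | Ax < b}` (componentwise strict inequalities). -/
def openPolyhedron {l d : ℕ} (A : Matrix (Fin l) (Fin d) ℝ) (b : Fin l → ℝ) :
    Set (Fin d → ℝ) :=
  {x | ∀ i, (A.mulVec x) i < b i}

/-- The closed polyhedron `{x | Ax ≤ b}`. -/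
def closedPolyhedron {l d : ℕ} (A : Matrix (Fin l) (Fin d) ℝ) (b : Fin l → ℝ) :
    Set (Fin d → ℝ) :=
  {x | ∀ i, (A.mulVec x) i ≤ b i}

/-! ## The real RAM

A storage cell holds one real number. There are registers, addressed directly, and memory banks,
whose cells are addressed indirectly through the content of a register, which then has to be a
natural number. A program names only finitely many registers and banks. Each arithmetic operation,
each assignment, each memory access and each comparison costs one unit. There is no rounding
operation, and the only constants are integers. -/

namespace RealRAM

/-- The contents of the storage: registers, and memory banks (`bank a i` is cell `i` of bank `a`). -/
structure State where
  reg : ℕ → ℝ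
  bank : ℕ → ℕ → ℝ

/-- Overwrite register `x`. -/
def State.setReg (s : State) (x : ℕ) (v : ℝ) : State :=
  { s with reg := Function.update s.reg x v }

/-- Overwrite cell `i` of bank `a`. -/
def State.setBank (s : State) (a i : ℕ) (v : ℝ) : State :=
  { s with bank := Function.update s.bank a (Function.update (s.bank a) i v) }

/-- The four arithmetic operations. -/
inductive Op
  | add | sub | mul | div

/-- Comparisons of two registers. -/
inductive Test
  | lt (x y : ℕ)
  | le (x y : ℕ)
  | eq (x y : ℕ)

/-- Truth of a comparison in a given state. -/
def Test.Holds : Test → State → Prop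
  | .lt x y, s => s.reg x < s.reg y
  | .le x y, s => s.reg x ≤ s.reg y
  | .eq x y, s => s.reg x = s.reg y

/-- Programs. -/
inductive Program
  /-- no operation -/
  | skip
  /-- `reg x := c` -/
  | const (x : ℕ) (c : ℤ)
  /-- `reg x := reg y` -/
  | copy (x y : ℕ)
  /-- `reg x := reg y ∘ reg z` -/
  | arith (o : Op) (x y z : ℕ)
  /-- `reg x := bank a [reg y]` -/
  | load (x a y : ℕ)
  /-- `bank a [reg x] := reg y` -/
  | store (a x y : ℕ)
  /-- first `c₁`, then `c₂` -/
  | seq (c₁ c₂ : Program)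
  /-- `if b then c₁ else c₂` -/
  | ite (b : Test) (c₁ c₂ : Program)
  /-- `while b do c` -/
  | loop (b : Test) (c : Program)

/-- `Exec c s t n`: started in state `s`, the program `c` halts in state `t` after exactly `n`
elementary operations. A division by zero, and an access to a cell whose address is not a natural
number, are errors: there is then no `t`. -/
inductive Exec : Program → State → State → ℕ → Prop
  | skip (s : State) : Exec .skip s s 0
  | const (s : State) (x : ℕ) (c : ℤ) : Exec (.const x c) s (s.setReg x (c : ℝ)) 1
  | copy (s : State) (x y : ℕ) : Exec (.copy x y) s (s.setReg x (s.reg y)) 1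
  | add (s : State) (x y z : ℕ) :
      Exec (.arith .add x y z) s (s.setReg x (s.reg y + s.reg z)) 1
  | sub (s : State) (x y z : ℕ) :
      Exec (.arith .sub x y z) s (s.setReg x (s.reg y - s.reg z)) 1
  | mul (s : State) (x y z : ℕ) :
      Exec (.arith .mul x y z) s (s.setReg x (s.reg y * s.reg z)) 1
  | div (s : State) (x y z : ℕ) (h : s.reg z ≠ 0) :
      Exec (.arith .div x y z) s (s.setReg x (s.reg y / s.reg z)) 1
  | load (s : State) (x a y i : ℕ) (h : s.reg y = (i : ℝ)) :
      Exec (.load x a y) s (s.setReg x (s.bank a i)) 1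
  | store (s : State) (a x y i : ℕ) (h : s.reg x = (i : ℝ)) :
      Exec (.store a x y) s (s.setBank a i (s.reg y)) 1
  | seq (c₁ c₂ : Program) (s t u : State) (m n : ℕ) (h₁ : Exec c₁ s t m) (h₂ : Exec c₂ t u n) :
      Exec (.seq c₁ c₂) s u (m + n)
  | iteTrue (b : Test) (c₁ c₂ : Program) (s t : State) (n : ℕ) (hb : b.Holds s)
      (h : Exec c₁ s t n) : Exec (.ite b c₁ c₂) s t (n + 1)
  | iteFalse (b : Test) (c₁ c₂ : Program) (s t : State) (n : ℕ) (hb : ¬ b.Holds s)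
      (h : Exec c₂ s t n) : Exec (.ite b c₁ c₂) s t (n + 1)
  | loopDone (b : Test) (c : Program) (s : State) (hb : ¬ b.Holds s) : Exec (.loop b c) s s 1
  | loopStep (b : Test) (c : Program) (s t u : State) (m n : ℕ) (hb : b.Holds s)
      (h₁ : Exec c s t m) (h₂ : Exec (.loop b c) t u n) : Exec (.loop b c) s u (m + n + 1)

/-- A vector as a bank: entry `i` in cell `i`, all other cells `0`. -/
def vecBank {m : ℕ} (v : Fin m → ℝ) : ℕ → ℝ :=
  fun i => if h : i < m then v ⟨i, h⟩ else 0

/-- A matrix as a bank, row by row: entry `(i, k)` of an `m × n` matrix in cell `i * n + k`,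
all other cells `0`. -/
def matBank {m n : ℕ} (M : Fin m → Fin n → ℝ) : ℕ → ℝ :=
  fun a => if h : a < m * n then M (Fin.divNat ⟨a, h⟩) (Fin.modNat ⟨a, h⟩) else 0

/-- The initial state for the window given by `A`, `b` and the points `p 0, …, p (q - 1)`:
registers `0` and `1` hold `l` and `q`, banks `0`, `1` and `2` hold `A`, `b` and the coordinates of
the points; everything else is `0`. -/
def sepInput {l d q : ℕ} (A : Matrix (Fin l) (Fin d) ℝ) (b : Fin l → ℝ)
    (p : Fin q → Fin d → ℝ) : State where
  reg x := match x with
    | 0 => (l : ℝ)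
    | 1 => (q : ℝ)
    | _ => 0
  bank a := match a with
    | 0 => matBank A
    | 1 => vecBank b
    | 2 => matBank p
    | _ => fun _ => 0

/-- The state `s` displays the family `F` of subsets of `{p 0, …, p (q - 1)}`: register `0` holds
the length `m` of a list of subsets, the `r`-th of which is stored as its `0`-`1` incidence vector
in the cells `r * q, …, r * q + q - 1` of bank `3`; the members of the list are exactly the
members of `F`. -/
def Displays {d q : ℕ} (s : State) (p : Fin q → Fin d → ℝ) (F : Set (Set (Fin d → ℝ))) : Prop :=
  ∃ m : ℕ, s.reg 0 = (m : ℝ) ∧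
    (∀ r < m, ∀ j : Fin q, s.bank 3 (r * q + j) = 0 ∨ s.bank 3 (r * q + j) = 1) ∧
    F = {S | ∃ r < m, S = {x | ∃ j : Fin q, p j = x ∧ s.bank 3 (r * q + j) = 1}}

/-- On input `A`, `b` and the points `p j`, the program `c` halts after at most `N` elementary
operations and displays the family `F`. -/
def ComputesWithin (c : Program) {l d q : ℕ} (A : Matrix (Fin l) (Fin d) ℝ) (b : Fin l → ℝ)
    (p : Fin q → Fin d → ℝ) (F : Set (Set (Fin d → ℝ))) (N : ℕ) : Prop :=
  ∃ (s : State) (n : ℕ), Exec c (sepInput A b p) s n ∧ n ≤ N ∧ Displays s p F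

end RealRAM

/-!
A point `p j` lies in `t + W` iff `A i ⬝ᵥ p j - b i < A i ⬝ᵥ t` for all `i`, so the sets
`P ∩ (t + W)` are determined by the cells of an arrangement of `l * q` hyperplanes in the space of
the translations `t`. Adding the coordinate hyperplanes makes the normals span. Then the closure of
every cell has a vertex; induction on the dimension, inside a hyperplane through that vertex, yields
`d` independent hyperplanes and signs `s k` such that the points `T ε` at which the `k`-th of them
takes the value `s k * ε ^ (k + 1)` lie in the cell for all small `ε > 0`. On the other hand every
choice of hyperplanes and signs describes points of a single cell. By Cramer's rule the position of
`T ε` with respect to a hyperplane is, for small `ε`, the lexicographic sign of a vector of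
polynomials in the data. The program runs through all `O(l q)^d` choices and tests, for each of
them, all `l * q` inequalities.
-/

open Filter Topology

section Arrangement

/-- Moving from `x` in direction `y` until the first of the coordinates that change vanishes. -/
lemma exists_add_mul_eq_zero_of_ne_zero {ι : Type*} [Finite ι] {x y : ι → ℝ}
    (hy : ∃ i, y i ≠ 0) :
    ∃ τ : ℝ, (∃ k, y k ≠ 0 ∧ x k + τ * y k = 0) ∧ ∀ i, |τ * y i| ≤ |x i| := by
  obtain ⟨k, hk, hmin⟩ :=
    Set.exists_min_image {i | y i ≠ 0} (fun i ↦ |x i / y i|) (Set.toFinite _) hy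
  have hk : y k ≠ 0 := hk
  refine ⟨-(x k / y k), ⟨k, hk, by field_simp; ring⟩, fun i ↦ ?_⟩
  by_cases hi : y i = 0
  · simp [hi]
  · calc |-(x k / y k) * y i| = |x k / y k| * |y i| := by rw [abs_mul, abs_neg]
      _ ≤ |x i / y i| * |y i| := mul_le_mul_of_nonneg_right (hmin i hi) (abs_nonneg _)
      _ = |x i| := by rw [← abs_mul, div_mul_cancel₀ _ hi]

lemma sign_add_eq_of_abs_le {x y : ℝ} (h : |y| ≤ |x|) (hxy : x + y ≠ 0) :
    SignType.sign (x + y) = SignType.sign x := by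
  rcases lt_trichotomy x 0 with hx | rfl | hx
  · rw [abs_of_neg hx, abs_le] at h
    rw [sign_neg hx, sign_neg (lt_of_le_of_ne (by linarith) hxy)]
  · simp_all
  · rw [abs_of_pos hx, abs_le] at h
    rw [sign_pos hx, sign_pos (lt_of_le_of_ne (by linarith) hxy.symm)]

lemma exists_pos_mul_eq_sign (x : ℝ) : ∃ κ > 0, κ * x = (SignType.sign x : ℝ) := by
  rcases eq_or_ne x 0 with rfl | hx
  · exact ⟨1, one_pos, by simp⟩
  · exact ⟨|x|⁻¹, by positivity, by
      rw [inv_mul_eq_div, div_eq_iff (abs_ne_zero.2 hx), sign_mul_abs]⟩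

variable {V ι : Type*} [AddCommGroup V] [Module ℝ V]

/-- The point `v` lies in the closure of the cell of `t₀` in the arrangement of the hyperplanes
`a i x = c i`. -/
def InClosedCell (a : ι → V →ₗ[ℝ] ℝ) (c : ι → ℝ) (t₀ v : V) : Prop :=
  ∀ i, a i v = c i ∨ SignType.sign (a i v - c i) = SignType.sign (a i t₀ - c i)

lemma InClosedCell.exists_ssubset [Finite ι] {a : ι → V →ₗ[ℝ] ℝ} {c : ι → ℝ} {t₀ v x : V}
    (hv : InClosedCell a c t₀ v) (hx : ∀ i, a i v = c i → a i x = 0) (hx₀ : ∃ i, a i x ≠ 0) :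
    ∃ v', InClosedCell a c t₀ v' ∧ {i | a i v = c i} ⊂ {i | a i v' = c i} := by
  obtain ⟨τ, ⟨k, hkx, hk⟩, hτ⟩ :=
    exists_add_mul_eq_zero_of_ne_zero (x := fun i ↦ a i v - c i) (y := fun i ↦ a i x) hx₀
  have hval i : a i (v + τ • x) - c i = (a i v - c i) + τ * a i x := by
    rw [map_add, map_smul, smul_eq_mul, add_sub_right_comm]
  refine ⟨v + τ • x, fun i ↦ or_iff_not_imp_left.2 fun hi ↦ ?_, fun i hi ↦ ?_, fun h ↦ ?_⟩
  · have hne : (a i v - c i) + τ * a i x ≠ 0 := by rwa [← hval, sub_ne_zero]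
    rw [hval, sign_add_eq_of_abs_le (hτ i) hne]
    refine (hv i).resolve_left fun h ↦ hne ?_
    rw [h, hx i h, sub_self, mul_zero, add_zero]
  · rw [Set.mem_ofPred_eq, ← sub_eq_zero, hval, show a i v = c i from hi, hx i hi]
    simp
  · exact hkx (hx k (h (sub_eq_zero.1 ((hval k).trans hk))))

lemma exists_vertex_inClosedCell [Finite ι] {a : ι → V →ₗ[ℝ] ℝ}
    (ha : ∀ x, (∀ i, a i x = 0) → x = 0) (c : ι → ℝ) (t₀ : V) :
    ∃ v, InClosedCell a c t₀ v ∧ ∀ x, (∀ i, a i v = c i → a i x = 0) → x = 0 := by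
  obtain ⟨Z, hZ⟩ := (Set.toFinite
    ((fun v ↦ {i | a i v = c i}) '' {v | InClosedCell a c t₀ v})).exists_maximal
      ⟨_, t₀, fun _ ↦ Or.inr rfl, rfl⟩
  obtain ⟨⟨v, hv, rfl⟩, hmax⟩ := hZ
  refine ⟨v, hv, fun x hx ↦ by_contra fun hx₀ ↦ ?_⟩
  obtain ⟨v', hv', hlt⟩ := InClosedCell.exists_ssubset hv hx (by
    by_contra! h
    exact hx₀ (ha x h))
  exact hlt.2 (hmax ⟨v', hv', rfl⟩ hlt.1)

end Arrangement

section FlagCurve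

/-- A continuous curve `ε ↦ curve ε` on which the `k`-th of `n` hyperplanes that meet in a single
point takes the value `0` or `± ε ^ (k + 1)`. It describes the cell of the arrangement that contains
the points of the curve for small `ε > 0`. -/
structure FlagCurve {V ι : Type*} [NormedAddCommGroup V] [NormedSpace ℝ V]
    (a : ι → V →ₗ[ℝ] ℝ) (c : ι → ℝ) (n : ℕ) where
  row : Fin n → ι
  shift : Fin n → SignType
  curve : ℝ → V
  continuous_curve : Continuous curve
  eq_zero_of_row : ∀ x, (∀ k, a (row k) x = 0) → x = 0
  apply_curve : ∀ ε k, a (row k) (curve ε) - c (row k) = (shift k : ℝ) * ε ^ ((k : ℕ) + 1)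

namespace FlagCurve

variable {V : Type*} [NormedAddCommGroup V] [NormedSpace ℝ V]

lemma apply_add_smul (f : V →ₗ[ℝ] ℝ) (v w e : V) (ε γ : ℝ) (σ : ℝ) :
    f (v + ε • (w + σ • e)) - γ = (f v - γ) + ε * (f w - -(σ * f e)) := by
  simp only [map_add, map_smul, smul_eq_mul]
  ring

variable {ι : Type*} {a : ι → V →ₗ[ℝ] ℝ} {c : ι → ℝ} {n : ℕ}

/-- The flag curve starting at the vertex `v`, whose first hyperplane is `k` and which continues, in
the direction of the hyperplane `k`, with the flag curve `Φ` of the hyperplanes through `v`. -/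
def cons {v e : V} {k : ι} (hk : a k v = c k) (he : a k e = 1) (σ : SignType)
    (Φ : FlagCurve (fun i : {i // a i v = c i} ↦ a i ∘ₗ (LinearMap.ker (a k)).subtype)
      (fun i ↦ -(σ * a i e)) n) : FlagCurve a c (n + 1) where
  row := Fin.cons k fun j ↦ Φ.row j
  shift := Fin.cons σ Φ.shift
  curve ε := v + ε • ((Φ.curve ε : V) + (σ : ℝ) • e)
  continuous_curve := by
    have := Φ.continuous_curve
    fun_prop
  eq_zero_of_row x hx :=
    congrArg Subtype.val (Φ.eq_zero_of_row ⟨x, hx 0⟩ fun j ↦ hx j.succ)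
  apply_curve ε j := by
    rw [apply_add_smul]
    refine Fin.cases ?_ (fun j ↦ ?_) j
    · have hker : a k (Φ.curve ε) = 0 := (Φ.curve ε).2
      simp [hk, he, hker, mul_comm]
    · have hΦ := Φ.apply_curve ε j
      simp only [LinearMap.comp_apply, Submodule.subtype_apply] at hΦ
      simp only [Fin.cons_succ, Fin.val_succ, hΦ, (Φ.row j).2]
      ring

lemma eventually_sign_cons [Finite ι] [FiniteDimensional ℝ V] {v e t₀ : V} {k : ι}
    (hk : a k v = c k) (he : a k e = 1) (σ : SignType)
    (Φ : FlagCurve (fun i : {i // a i v = c i} ↦ a i ∘ₗ (LinearMap.ker (a k)).subtype)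
      (fun i ↦ -(σ * a i e)) n)
    (hv : InClosedCell a c t₀ v)
    (hΦ : ∀ᶠ ε in 𝓝[>] (0 : ℝ), ∀ i : {i // a i v = c i},
      SignType.sign (a i (Φ.curve ε) - -(σ * a i e)) = SignType.sign (a i t₀ - c i)) :
    ∀ᶠ ε in 𝓝[>] (0 : ℝ), ∀ i,
      SignType.sign (a i ((cons hk he σ Φ).curve ε) - c i) = SignType.sign (a i t₀ - c i) := by
  refine eventually_all.2 fun i ↦ ?_
  by_cases hi : a i v = c i
  · filter_upwards [hΦ, eventually_mem_nhdsWithin] with ε hε hpos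
    have hpos : 0 < ε := hpos
    rw [cons, apply_add_smul, hi, sub_self, zero_add, sign_mul, sign_pos hpos, one_mul,
      hε ⟨i, hi⟩]
  · have hcont : Continuous fun ε ↦ a i ((cons hk he σ Φ).curve ε) - c i :=
      ((a i).continuous_of_finiteDimensional.comp (cons hk he σ Φ).continuous_curve).sub
        continuous_const
    have h₀ : a i ((cons hk he σ Φ).curve 0) - c i = a i v - c i := by simp [cons]
    have hsign := (continuousAt_sign_of_ne_zero (h₀ ▸ sub_ne_zero.2 hi)).comp_of_eq
      hcont.continuousAt rfl
    filter_upwards [nhdsWithin_le_nhds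
      (hsign.eventually_mem ((isOpen_discrete {SignType.sign _}).mem_nhds rfl))] with ε hε
    rw [show SignType.sign _ = SignType.sign _ from hε, h₀]
    exact (hv i).resolve_left hi

theorem exists_eventually_sign_eq {V : Type*} [NormedAddCommGroup V] [NormedSpace ℝ V]
    [FiniteDimensional ℝ V] (hn : Module.finrank ℝ V = n) {ι : Type*} [Finite ι]
    {a : ι → V →ₗ[ℝ] ℝ} (ha : ∀ x, (∀ i, a i x = 0) → x = 0) (c : ι → ℝ) (t₀ : V) :
    ∃ Φ : FlagCurve a c n, ∀ᶠ ε in 𝓝[>] (0 : ℝ), ∀ i,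
      SignType.sign (a i (Φ.curve ε) - c i) = SignType.sign (a i t₀ - c i) := by
  induction n generalizing V ι with
  | zero =>
    have := Module.finrank_zero_iff.1 hn
    exact ⟨⟨Fin.elim0, Fin.elim0, fun _ ↦ t₀, continuous_const, fun x _ ↦ Subsingleton.elim _ _,
      fun _ k ↦ k.elim0⟩, Eventually.of_forall fun _ _ ↦ rfl⟩
  | succ n ih =>
    obtain ⟨v, hv, hspan⟩ := exists_vertex_inClosedCell ha c t₀
    obtain ⟨k, hk, hak⟩ : ∃ k, a k v = c k ∧ a k ≠ 0 := by
      have : Nontrivial V := Module.nontrivial_of_finrank_pos (R := ℝ) (by lia)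
      obtain ⟨x, hx⟩ := exists_ne (0 : V)
      by_contra! h
      exact hx (hspan x fun i hi ↦ by rw [h i hi, LinearMap.zero_apply])
    obtain ⟨e, he⟩ := LinearMap.surjective hak 1
    obtain ⟨κ, hκ, hκs⟩ := exists_pos_mul_eq_sign (a k (t₀ - v))
    set σ := SignType.sign (a k (t₀ - v))
    have hker : κ • (t₀ - v) - (σ : ℝ) • e ∈ LinearMap.ker (a k) := by
      rw [LinearMap.mem_ker, map_sub, map_smul, map_smul, he, smul_eq_mul, hκs, smul_eq_mul,
        mul_one, sub_self]
    have hrank : Module.finrank ℝ (LinearMap.ker (a k)) = n := by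
      have := Module.Dual.finrank_ker_add_one_of_ne_zero (f := a k) hak
      lia
    obtain ⟨Φ, hΦ⟩ := ih hrank
      (a := fun i : {i // a i v = c i} ↦ a i ∘ₗ (LinearMap.ker (a k)).subtype)
      (fun x hx ↦ Subtype.ext (hspan x fun i hi ↦ hx ⟨i, hi⟩)) (fun i ↦ -(σ * a i e)) ⟨_, hker⟩
    refine ⟨cons hk he σ Φ, eventually_sign_cons hk he σ Φ hv (hΦ.mono fun ε hε i ↦ ?_)⟩
    -- the point of `ker (a k)` handed to the induction is, modulo `e`, a positive multiple of
    -- `t₀ - v`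
    calc SignType.sign (a i (Φ.curve ε) - -(σ * a i e))
        = SignType.sign (a i (κ • (t₀ - v) - (σ : ℝ) • e) - -(σ * a i e)) := hε i
      _ = SignType.sign (κ * (a i t₀ - c i)) := by
        congr 1
        rw [map_sub, map_smul, map_smul, map_sub, i.2, smul_eq_mul, smul_eq_mul]
        ring
      _ = SignType.sign (a i t₀ - c i) := by rw [sign_mul, sign_pos hκ, one_mul]

end FlagCurve

end FlagCurve

section LexicographicSign

lemma zero_lt_toLex_iff {n : ℕ} (v : Fin (n + 1) → ℝ) :
    0 < toLex v ↔ 0 < v 0 ∨ v 0 = 0 ∧ 0 < toLex (Fin.tail v) := by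
  have h {m : ℕ} (w : Fin m → ℝ) : 0 < toLex w ↔ ∃ i, (∀ j < i, 0 = w j) ∧ 0 < w i := Iff.rfl
  simp only [h, Fin.exists_fin_succ, Fin.forall_fin_succ, Fin.not_lt_zero, Fin.succ_lt_succ_iff,
    Fin.succ_pos, Fin.tail, eq_comm (a := (0 : ℝ))]
  aesop

lemma eventually_sum_mul_pow_pos_iff {n : ℕ} (v : Fin n → ℝ) :
    ∀ᶠ ε in 𝓝[>] (0 : ℝ), (0 < ∑ k, v k * ε ^ (k : ℕ) ↔ 0 < toLex v) := by
  induction n with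
  | zero => exact Eventually.of_forall fun ε ↦ by simp [show ¬0 < toLex v from fun ⟨i, _⟩ ↦ i.elim0]
  | succ n ih =>
    have hsum ε : ∑ k, v k * ε ^ (k : ℕ) = v 0 + ε * ∑ k, Fin.tail v k * ε ^ (k : ℕ) := by
      simp only [Fin.sum_univ_succ, Fin.val_zero, pow_zero, mul_one, Fin.val_succ, Finset.mul_sum,
        Fin.tail, pow_succ', mul_left_comm ε]
    simp only [zero_lt_toLex_iff, hsum]
    rcases eq_or_ne (v 0) 0 with h₀ | h₀
    · filter_upwards [ih (Fin.tail v), eventually_mem_nhdsWithin] with ε hε hpos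
      rw [h₀, zero_add, mul_pos_iff_of_pos_left hpos, hε]
      simp
    · have hcont : Continuous fun ε ↦ v 0 + ε * ∑ k, Fin.tail v k * ε ^ (k : ℕ) := by fun_prop
      have htend := (hcont.tendsto' 0 (v 0) (by simp)).mono_left (nhdsWithin_le_nhds (s := .Ioi 0))
      rcases h₀.lt_or_gt with h | h
      · filter_upwards [htend.eventually_lt_const h] with ε hε
        simp [h₀, h.not_gt, hε.not_gt]
      · filter_upwards [htend.eventually_const_lt h] with ε hε
        simp [h, hε]

end LexicographicSign

section Coefficients

variable {d : ℕ}

/-- For the solution `T` of `M T = c + (s k * ε ^ (k + 1))_k`, the coefficients of the polynomial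
`(det M)² (a ⬝ᵥ T - γ)` in `ε`. -/
noncomputable def cellCoeff (M : Matrix (Fin d) (Fin d) ℝ) (c s a : Fin d → ℝ) (γ : ℝ) :
    Fin (d + 1) → ℝ :=
  Fin.cons (M.det * (Matrix.vecMul a M.adjugate ⬝ᵥ c - γ * M.det))
    fun k ↦ M.det * (Matrix.vecMul a M.adjugate k * s k)

lemma sum_cellCoeff_mul_pow (M : Matrix (Fin d) (Fin d) ℝ) (c s a : Fin d → ℝ) (γ ε : ℝ)
    {T : Fin d → ℝ} (hT : M.mulVec T = c + fun k : Fin d ↦ s k * ε ^ ((k : ℕ) + 1)) :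
    ∑ k, cellCoeff M c s a γ k * ε ^ (k : ℕ) = M.det ^ 2 * (a ⬝ᵥ T - γ) := by
  have hCramer : Matrix.vecMul a M.adjugate ⬝ᵥ M.mulVec T = M.det * (a ⬝ᵥ T) := by
    rw [← Matrix.dotProduct_mulVec, Matrix.mulVec_mulVec, Matrix.adjugate_mul, Matrix.smul_mulVec,
      Matrix.one_mulVec, dotProduct_smul, smul_eq_mul]
  rw [hT, dotProduct_add] at hCramer
  have hshift : ∑ k : Fin d, M.det * (Matrix.vecMul a M.adjugate k * s k) * ε ^ ((k : ℕ) + 1) =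
      M.det * (Matrix.vecMul a M.adjugate ⬝ᵥ fun k : Fin d ↦ s k * ε ^ ((k : ℕ) + 1)) := by
    simp only [dotProduct, Finset.mul_sum, mul_assoc]
  rw [Fin.sum_univ_succ]
  simp only [cellCoeff, Fin.cons_zero, Fin.cons_succ, Fin.val_zero, pow_zero, mul_one, Fin.val_succ,
    hshift]
  linear_combination M.det * hCramer

lemma eventually_zero_lt_cellCoeff_iff {M : Matrix (Fin d) (Fin d) ℝ} (hM : M.det ≠ 0)
    (c s a : Fin d → ℝ) (γ : ℝ) {T : ℝ → Fin d → ℝ}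
    (hT : ∀ ε, M.mulVec (T ε) = c + fun k : Fin d ↦ s k * ε ^ ((k : ℕ) + 1)) :
    ∀ᶠ ε in 𝓝[>] (0 : ℝ), (0 < toLex (cellCoeff M c s a γ) ↔ γ < a ⬝ᵥ T ε) := by
  filter_upwards [eventually_sum_mul_pow_pos_iff (cellCoeff M c s a γ)] with ε hε
  rw [← hε, sum_cellCoeff_mul_pow M c s a γ ε (hT ε), mul_pos_iff_of_pos_left (by positivity),
    sub_pos]

theorem exists_flag_cellCoeff_pos_iff {ι : Type*} [Finite ι] {a : ι → Fin d → ℝ}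
    (ha : ∀ x, (∀ i, a i ⬝ᵥ x = 0) → x = 0) (c : ι → ℝ) (t₀ : Fin d → ℝ) :
    ∃ (w : Fin d → ι) (s : Fin d → SignType), (Matrix.of fun k ↦ a (w k)).det ≠ 0 ∧ ∀ i,
      (0 < toLex (cellCoeff (.of fun k ↦ a (w k)) (fun k ↦ c (w k)) (fun k ↦ s k) (a i) (c i)) ↔
        c i < a i ⬝ᵥ t₀) := by
  obtain ⟨Φ, hΦ⟩ := FlagCurve.exists_eventually_sign_eq (Module.finrank_fin_fun ℝ)
    (a := fun i ↦ dotProductBilin ℝ ℝ (a i)) ha c t₀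
  have hdet : (Matrix.of fun k ↦ a (Φ.row k)).det ≠ 0 := fun h ↦ by
    obtain ⟨x, hx, hMx⟩ := Matrix.exists_mulVec_eq_zero_iff.2 h
    exact hx (Φ.eq_zero_of_row x fun k ↦ congrFun hMx k)
  refine ⟨Φ.row, Φ.shift, hdet, fun i ↦ ?_⟩
  have hT ε : (Matrix.of fun k ↦ a (Φ.row k)).mulVec (Φ.curve ε) =
      (fun k ↦ c (Φ.row k)) + fun k : Fin d ↦ (Φ.shift k : ℝ) * ε ^ ((k : ℕ) + 1) :=
    funext fun k ↦ sub_eq_iff_eq_add'.1 (Φ.apply_curve ε k)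
  obtain ⟨ε, hcell, hcoeff⟩ :=
    (hΦ.and (eventually_zero_lt_cellCoeff_iff hdet _ _ (a i) (c i) hT)).exists
  have hsign : SignType.sign (a i ⬝ᵥ Φ.curve ε - c i) = SignType.sign (a i ⬝ᵥ t₀ - c i) := hcell i
  rw [hcoeff, ← sub_pos, ← sign_eq_one_iff, hsign, sign_eq_one_iff, sub_pos]

theorem exists_point_cellCoeff_pos_iff {ι : Type*} [Finite ι] {M : Matrix (Fin d) (Fin d) ℝ}
    (hM : M.det ≠ 0) (c s : Fin d → ℝ) (a : ι → Fin d → ℝ) (γ : ι → ℝ) :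
    ∃ t : Fin d → ℝ, ∀ i, (0 < toLex (cellCoeff M c s (a i) (γ i)) ↔ γ i < a i ⬝ᵥ t) := by
  have hT (ε : ℝ) : M.mulVec (M⁻¹.mulVec (c + fun k : Fin d ↦ s k * ε ^ ((k : ℕ) + 1))) =
      c + fun k : Fin d ↦ s k * ε ^ ((k : ℕ) + 1) := by
    rw [Matrix.mulVec_mulVec, Matrix.mul_nonsing_inv _ hM.isUnit, Matrix.one_mulVec]
  obtain ⟨ε, hε⟩ := (eventually_all.2 fun i ↦
    eventually_zero_lt_cellCoeff_iff hM c s (a i) (γ i) hT).exists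
  exact ⟨_, hε⟩

end Coefficients

section Polyhedra

variable {l d : ℕ}

lemma mem_sepPart_openPolyhedron {A : Matrix (Fin l) (Fin d) ℝ} {b : Fin l → ℝ}
    {P : Set (Fin d → ℝ)} {t x : Fin d → ℝ} :
    x ∈ sepPart (openPolyhedron A b) P t ↔ x ∈ P ∧ ∀ i, A i ⬝ᵥ x - b i < A i ⬝ᵥ t := by
  refine and_congr_right fun _ ↦ ?_
  rw [Set.image_add_left, Set.mem_preimage, neg_add_eq_sub]
  refine forall_congr' fun i ↦ ?_
  rw [Matrix.mulVec, dotProduct_sub]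
  constructor <;> intro <;> linarith

lemma isOpen_openPolyhedron (A : Matrix (Fin l) (Fin d) ℝ) (b : Fin l → ℝ) :
    IsOpen (openPolyhedron A b) := by
  rw [openPolyhedron, Set.ofPred_forall]
  exact isOpen_iInter_of_finite fun i ↦ isOpen_lt (by fun_prop) continuous_const

lemma interior_closedPolyhedron_subset {A : Matrix (Fin l) (Fin d) ℝ} (hA : ∀ i, A i ≠ 0)
    (b : Fin l → ℝ) : interior (closedPolyhedron A b) ⊆ openPolyhedron A b := by
  intro x hx i
  have hcont : Continuous fun ε : ℝ ↦ x + ε • A i := by fun_prop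
  have htend := (hcont.tendsto' 0 x (by simp)).mono_left (nhdsWithin_le_nhds (s := .Ioi 0))
  obtain ⟨ε, hmem, hε⟩ := ((htend.eventually (mem_interior_iff_mem_nhds.1 hx)).and
    eventually_mem_nhdsWithin).exists
  have hε : 0 < ε := hε
  have hnorm : 0 < A i ⬝ᵥ A i := lt_of_le_of_ne (Finset.sum_nonneg fun k _ ↦ mul_self_nonneg _)
    fun h ↦ hA i (dotProduct_self_eq_zero.1 h.symm)
  calc A i ⬝ᵥ x < A i ⬝ᵥ x + ε * (A i ⬝ᵥ A i) := lt_add_of_pos_right _ (mul_pos hε hnorm)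
    _ = A i ⬝ᵥ (x + ε • A i) := by rw [dotProduct_add, dotProduct_smul, smul_eq_mul]
    _ ≤ b i := hmem i

lemma interior_closedPolyhedron {A : Matrix (Fin l) (Fin d) ℝ} (hA : ∀ i, A i ≠ 0)
    (b : Fin l → ℝ) : interior (closedPolyhedron A b) = openPolyhedron A b :=
  (interior_closedPolyhedron_subset hA b).antisymm
    (interior_maximal (fun _ hx i ↦ (hx i).le) (isOpen_openPolyhedron A b))

end Polyhedra

namespace RealRAM

section HaltsWithin

/-- Started in the state `s`, the program `c` halts after at most `K` operations, in a state that
satisfies `Q`. -/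
def HaltsWithin (c : Program) (s : State) (K : ℕ) (Q : State → Prop) : Prop :=
  ∃ t n, Exec c s t n ∧ n ≤ K ∧ Q t

variable {c c₁ c₂ : Program} {s : State} {K L : ℕ} {P Q : State → Prop}

lemma HaltsWithin.of_exec {t : State} (h : Exec c s t K) (hQ : Q t) : HaltsWithin c s K Q :=
  ⟨t, K, h, le_rfl, hQ⟩

lemma HaltsWithin.mono (h : HaltsWithin c s K P) (hKL : K ≤ L) (hPQ : ∀ t, P t → Q t) :
    HaltsWithin c s L Q :=
  let ⟨t, n, hexec, hn, hP⟩ := h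
  ⟨t, n, hexec, hn.trans hKL, hPQ t hP⟩

lemma HaltsWithin.seq (h₁ : HaltsWithin c₁ s K P) (h₂ : ∀ t, P t → HaltsWithin c₂ t L Q) :
    HaltsWithin (.seq c₁ c₂) s (K + L) Q := by
  obtain ⟨t, m, hexec₁, hm, hP⟩ := h₁
  obtain ⟨u, n, hexec₂, hn, hQ⟩ := h₂ t hP
  exact ⟨u, m + n, .seq _ _ _ _ _ _ _ hexec₁ hexec₂, add_le_add hm hn, hQ⟩

lemma HaltsWithin.ite {b : Test} (h₁ : b.Holds s → HaltsWithin c₁ s K Q)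
    (h₂ : ¬b.Holds s → HaltsWithin c₂ s L Q) : HaltsWithin (.ite b c₁ c₂) s (max K L + 1) Q := by
  by_cases hb : b.Holds s
  · obtain ⟨t, n, hexec, hn, hQ⟩ := h₁ hb
    exact ⟨t, n + 1, .iteTrue _ _ _ _ _ _ hb hexec, by lia, hQ⟩
  · obtain ⟨t, n, hexec, hn, hQ⟩ := h₂ hb
    exact ⟨t, n + 1, .iteFalse _ _ _ _ _ _ hb hexec, by lia, hQ⟩

lemma HaltsWithin.loop_step {b : Test} (hb : b.Holds s) (h₁ : HaltsWithin c s K P)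
    (h₂ : ∀ t, P t → HaltsWithin (.loop b c) t L Q) :
    HaltsWithin (.loop b c) s (K + L + 1) Q := by
  obtain ⟨t, m, hexec₁, hm, hP⟩ := h₁
  obtain ⟨u, n, hexec₂, hn, hQ⟩ := h₂ t hP
  exact ⟨u, m + n + 1, .loopStep _ _ _ _ _ _ _ hb hexec₁ hexec₂, by lia, hQ⟩

end HaltsWithin

section Memory

/-- The storage as seen by programs all of whose registers hold natural numbers, except for
registers used as scratch space. -/
@[ext]
structure Memory where
  reg : ℕ → ℕ
  bank : ℕ → ℕ → ℝ

namespace Memory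

/-- Overwrite register `x`. -/
def setReg (σ : Memory) (x v : ℕ) : Memory :=
  { σ with reg := Function.update σ.reg x v }

/-- Overwrite cell `i` of bank `a`. -/
def setBank (σ : Memory) (a i : ℕ) (v : ℝ) : Memory :=
  { σ with bank := Function.update σ.bank a (Function.update (σ.bank a) i v) }

/-- Overwrite the cells `i, …, i + n - 1` of bank `a` by `v 0, …, v (n - 1)`. -/
def setBlock (σ : Memory) (a i n : ℕ) (v : ℕ → ℝ) : Memory :=
  { σ with
    bank := Function.update σ.bank a fun k ↦ if i ≤ k ∧ k < i + n then v (k - i) else σ.bank a k }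

/-- The state `s` has the content `σ`, the registers `V, V + 1, …` being scratch space. -/
def StoredIn (σ : Memory) (V : ℕ) (s : State) : Prop :=
  (∀ x < V, s.reg x = σ.reg x) ∧ s.bank = σ.bank

@[simp] lemma reg_setReg (σ : Memory) (x v : ℕ) :
    (σ.setReg x v).reg = Function.update σ.reg x v := rfl

@[simp] lemma bank_setReg (σ : Memory) (x v : ℕ) : (σ.setReg x v).bank = σ.bank := rfl

@[simp] lemma reg_setBank (σ : Memory) (a i : ℕ) (v : ℝ) : (σ.setBank a i v).reg = σ.reg := rfl

@[simp] lemma bank_setBank (σ : Memory) (a i : ℕ) (v : ℝ) :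
    (σ.setBank a i v).bank = Function.update σ.bank a (Function.update (σ.bank a) i v) := rfl

@[simp] lemma reg_setBlock (σ : Memory) (a i n : ℕ) (v : ℕ → ℝ) :
    (σ.setBlock a i n v).reg = σ.reg := rfl

@[simp] lemma bank_setBlock (σ : Memory) (a i n : ℕ) (v : ℕ → ℝ) : (σ.setBlock a i n v).bank =
    Function.update σ.bank a fun k ↦ if i ≤ k ∧ k < i + n then v (k - i) else σ.bank a k := rfl

@[simp] lemma setBlock_zero (σ : Memory) (a i : ℕ) (v : ℕ → ℝ) : σ.setBlock a i 0 v = σ := by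
  ext b k
  · rfl
  · rcases eq_or_ne b a with rfl | hb
    · simp [setBlock, (show ¬(i ≤ k ∧ k < i) by lia)]
    · simp [hb]

lemma setBank_setBlock (σ : Memory) (a i n : ℕ) (v : ℕ → ℝ) :
    (σ.setBlock a i n v).setBank a (i + n) (v n) = σ.setBlock a i (n + 1) v := by
  ext b k
  · rfl
  · rcases eq_or_ne b a with rfl | hb
    · simp only [bank_setBank, bank_setBlock, Function.update_self, Function.update_apply]
      grind
    · simp [hb]

@[simp] lemma setReg_setReg (σ : Memory) (x v w : ℕ) :
    (σ.setReg x v).setReg x w = σ.setReg x w := by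
  simp [setReg]

lemma setReg_eq_self {σ : Memory} {x v : ℕ} (h : σ.reg x = v) : σ.setReg x v = σ := by
  simp [setReg, ← h]

variable {σ : Memory} {V : ℕ} {s : State}

lemma StoredIn.setReg (h : σ.StoredIn V s) (x v : ℕ) :
    (σ.setReg x v).StoredIn V (s.setReg x v) := by
  refine ⟨fun y hy ↦ ?_, h.2⟩
  rcases eq_or_ne y x with rfl | hyx
  · simp [State.setReg]
  · simp [State.setReg, hyx, h.1 y hy]

lemma StoredIn.setReg_scratch (h : σ.StoredIn V s) {x : ℕ} (hx : V ≤ x) (v : ℝ) :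
    σ.StoredIn V (s.setReg x v) := by
  refine ⟨fun y hy ↦ ?_, h.2⟩
  simp [State.setReg, (hy.trans_le hx).ne, h.1 y hy]

lemma StoredIn.setBank (h : σ.StoredIn V s) (a i : ℕ) (v : ℝ) :
    (σ.setBank a i v).StoredIn V (s.setBank a i v) :=
  ⟨h.1, by simp [State.setBank, h.2]⟩

end Memory

/-- Started on the content `σ`, the program `c` halts after at most `K` operations, and the content
then satisfies `Q`; the registers `V, V + 1, …` are scratch space. -/
def Runs (V : ℕ) (c : Program) (σ : Memory) (K : ℕ) (Q : Memory → Prop) : Prop :=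
  ∀ s, σ.StoredIn V s → HaltsWithin c s K fun t ↦ ∃ τ, τ.StoredIn V t ∧ Q τ

variable {V : ℕ} {c c₁ c₂ : Program} {σ : Memory} {K L : ℕ} {P Q : Memory → Prop}

lemma Runs.mono (h : Runs V c σ K P) (hKL : K ≤ L) (hPQ : ∀ τ, P τ → Q τ) : Runs V c σ L Q :=
  fun s hs ↦ (h s hs).mono hKL fun _ ⟨τ, hτ, hP⟩ ↦ ⟨τ, hτ, hPQ τ hP⟩

lemma Runs.seq (h₁ : Runs V c₁ σ K P) (h₂ : ∀ τ, P τ → Runs V c₂ τ L Q) :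
    Runs V (.seq c₁ c₂) σ (K + L) Q :=
  fun s hs ↦ (h₁ s hs).seq fun t ⟨τ, hτ, hP⟩ ↦ h₂ τ hP t hτ

end Memory

section ForLoop

/-- Execute `c` for all values of the counter `x` below the content of register `y`. Counters are
`0` outside their loops; register `V` is scratch space. -/
def Program.forLoop (V x y : ℕ) (c : Program) : Program :=
  .seq (.loop (.lt x y) (.seq c (.seq (.const V 1) (.arith .add x x V)))) (.const x 0)

variable {V x y : ℕ}

lemma haltsWithin_increment (hx : x < V) {τ : Memory} {s : State} (hs : τ.StoredIn V s) :
    HaltsWithin (.seq (.const V 1) (.arith .add x x V)) s 2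
      ((τ.setReg x (τ.reg x + 1)).StoredIn V) := by
  refine (HaltsWithin.of_exec (.const s V 1) rfl).seq fun t ht ↦
    HaltsWithin.of_exec (.add t x x V) ?_
  subst ht
  have hsum : (s.setReg V (1 : ℤ)).reg x + (s.setReg V (1 : ℤ)).reg V = (τ.reg x + 1 : ℕ) := by
    simp [State.setReg, hx.ne, hs.1 x hx]
  rw [hsum]
  exact (hs.setReg_scratch le_rfl _).setReg x _

lemma Runs.forLoop (hx : x < V) (hy : y < V) (hxy : x ≠ y) {c : Program} {n K : ℕ}
    {I : ℕ → Memory → Prop} (hI : ∀ i σ, I i σ → σ.reg x = 0 ∧ σ.reg y = n)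
    (hbody : ∀ i < n, ∀ σ, I i σ →
      Runs V c (σ.setReg x i) K fun τ ↦ τ.reg x = i ∧ I (i + 1) (τ.setReg x 0))
    {σ : Memory} (hσ : I 0 σ) : Runs V (.forLoop V x y c) σ (n * (K + 3) + 2) (I n) := by
  let Inv (i : ℕ) (s : State) : Prop := ∃ σ, I i σ ∧ (σ.setReg x i).StoredIn V s
  let body : Program := .seq c (.seq (.const V 1) (.arith .add x x V))
  have htest {i : ℕ} {s : State} : Inv i s → ((Test.lt x y).Holds s ↔ i < n) := by
    rintro ⟨σ, hσ, hs⟩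
    rw [Test.Holds, hs.1 x hx, hs.1 y hy, Nat.cast_lt]
    simp [hxy.symm, (hI i σ hσ).2]
  have hstep {i : ℕ} (hi : i < n) {s : State} : Inv i s →
      HaltsWithin body s (K + 2) (Inv (i + 1)) := by
    rintro ⟨σ, hσ, hs⟩
    refine (hbody i hi σ hσ s hs).seq fun t ⟨τ, hτ, hτx, hIτ⟩ ↦
      (haltsWithin_increment hx hτ).mono le_rfl fun u hu ↦ ⟨τ.setReg x 0, hIτ, ?_⟩
    rwa [Memory.setReg_setReg, ← hτx]
  have hloop (k : ℕ) : ∀ i, i + k = n → ∀ s, Inv i s →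
      HaltsWithin (.loop (.lt x y) body) s (k * (K + 3) + 1) (Inv n) := by
    induction k with
    | zero =>
      rintro i rfl s hs
      exact (HaltsWithin.of_exec (.loopDone _ _ s (by simp [htest hs])) hs).mono (by lia)
        fun _ ↦ id
    | succ k ih =>
      exact fun i hi s hs ↦ (HaltsWithin.loop_step ((htest hs).2 (by lia)) (hstep (by lia) hs)
        (ih (i + 1) (by lia))).mono (le_of_eq (by ring)) fun _ ↦ id
  intro s hs
  have hstart : Inv 0 s := ⟨σ, hσ, by rwa [Memory.setReg_eq_self (hI 0 σ hσ).1]⟩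
  refine (hloop n 0 (zero_add n) s hstart).seq fun t ⟨τ, hτ, ht⟩ ↦
    HaltsWithin.of_exec (.const t x 0) ⟨τ, ?_, hτ⟩
  have hreset := ht.setReg x 0
  rw [Memory.setReg_setReg, Memory.setReg_eq_self (hI n τ hτ).1] at hreset
  exact_mod_cast hreset

end ForLoop

section Evaluable

/-- The states `s` and `t` have the same banks and the same registers below `r`. -/
def AgreesBelow (r : ℕ) (s t : State) : Prop :=
  (∀ x < r, t.reg x = s.reg x) ∧ t.bank = s.bank

lemma AgreesBelow.trans {r r' : ℕ} {s t u : State} (h : AgreesBelow r s t)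
    (h' : AgreesBelow r' t u) (hr : r ≤ r') : AgreesBelow r s u :=
  ⟨fun x hx ↦ (h'.1 x (hx.trans_le hr)).trans (h.1 x hx), h'.2.trans h.2⟩

lemma agreesBelow_setReg (s : State) (r : ℕ) (v : ℝ) : AgreesBelow r s (s.setReg r v) :=
  ⟨fun x hx ↦ by simp [State.setReg, hx.ne], rfl⟩

lemma Memory.StoredIn.of_agreesBelow {V r : ℕ} {σ : Memory} {s t : State} (hs : σ.StoredIn V s)
    (h : AgreesBelow r s t) (hr : V ≤ r) : σ.StoredIn V t :=
  ⟨fun x hx ↦ (h.1 x (hx.trans_le hr)).trans (hs.1 x hx), h.2.trans hs.2⟩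

/-- The real number `f σ` can be computed from the content `σ` in bounded time, using only scratch
registers, and put into any register `r` outside `0, …, V - 1` without affecting the registers
below `r`. -/
def Evaluable (V : ℕ) (f : Memory → ℝ) : Prop :=
  ∀ r ≥ V, ∃ c K, ∀ σ s, Memory.StoredIn σ V s →
    HaltsWithin c s K fun t ↦ t.reg r = f σ ∧ AgreesBelow r s t

namespace Evaluable

variable {V : ℕ} {f g : Memory → ℝ}

lemma of_exec (h : ∀ r ≥ V, ∃ c, ∀ σ s, Memory.StoredIn σ V s → Exec c s (s.setReg r (f σ)) 1) :
    Evaluable V f := fun r hr ↦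
  let ⟨c, hc⟩ := h r hr
  ⟨c, 1, fun _ _ hs ↦ .of_exec (hc _ _ hs) ⟨by simp [State.setReg], agreesBelow_setReg _ _ _⟩⟩

lemma intCast (V : ℕ) (z : ℤ) : Evaluable V fun _ ↦ (z : ℝ) :=
  of_exec fun r _ ↦ ⟨_, fun _ s _ ↦ .const s r z⟩

lemma natCast (V n : ℕ) : Evaluable V fun _ ↦ (n : ℝ) := by
  simpa using intCast V n

lemma zero (V : ℕ) : Evaluable V fun _ ↦ 0 := by
  simpa using natCast V 0

lemma one (V : ℕ) : Evaluable V fun _ ↦ 1 := by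
  simpa using natCast V 1

lemma reg {x : ℕ} (hx : x < V) : Evaluable V fun σ ↦ (σ.reg x : ℝ) :=
  of_exec fun r _ ↦ ⟨.copy r x, fun _ s hs ↦ hs.1 x hx ▸ .copy s r x⟩

lemma bank {i : Memory → ℕ} (hi : Evaluable V fun σ ↦ (i σ : ℝ)) (a : ℕ) :
    Evaluable V fun σ ↦ σ.bank a (i σ) := by
  intro r hr
  obtain ⟨c, K, hc⟩ := hi r hr
  refine ⟨.seq c (.load r a r), K + 1, fun σ s hs ↦ (hc σ s hs).seq fun t ⟨hval, hst⟩ ↦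
    .of_exec (.load t r a r (i σ) hval) ⟨?_, hst.trans (agreesBelow_setReg _ _ _) le_rfl⟩⟩
  simp [State.setReg, hst.2, hs.2]

lemma exists_pair (hf : Evaluable V f) (hg : Evaluable V g) {r : ℕ} (hr : V ≤ r) :
    ∃ c K, ∀ σ s, Memory.StoredIn σ V s →
      HaltsWithin c s K fun t ↦ t.reg r = f σ ∧ t.reg (r + 1) = g σ ∧ AgreesBelow r s t := by
  obtain ⟨c₁, K₁, h₁⟩ := hf r hr
  obtain ⟨c₂, K₂, h₂⟩ := hg (r + 1) (by lia)
  exact ⟨.seq c₁ c₂, K₁ + K₂, fun σ s hs ↦ (h₁ σ s hs).seq fun t ⟨hft, hst⟩ ↦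
    (h₂ σ t (hs.of_agreesBelow hst hr)).mono le_rfl fun u ⟨hgu, htu⟩ ↦
      ⟨(htu.1 r r.lt_succ_self).trans hft, hgu, hst.trans htu r.le_succ⟩⟩

lemma arith (hf : Evaluable V f) (hg : Evaluable V g) {o : Op} {φ : ℝ → ℝ → ℝ}
    (hφ : ∀ s x y z, Exec (.arith o x y z) s (s.setReg x (φ (s.reg y) (s.reg z))) 1) :
    Evaluable V fun σ ↦ φ (f σ) (g σ) := by
  intro r hr
  obtain ⟨c, K, hc⟩ := exists_pair hf hg hr
  refine ⟨.seq c (.arith o r r (r + 1)), K + 1, fun σ s hs ↦ (hc σ s hs).seq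
    fun t ⟨hft, hgt, hst⟩ ↦ .of_exec (hφ t r r (r + 1))
      ⟨by simp [State.setReg, hft, hgt], hst.trans (agreesBelow_setReg _ _ _) le_rfl⟩⟩

lemma add (hf : Evaluable V f) (hg : Evaluable V g) : Evaluable V fun σ ↦ f σ + g σ :=
  arith hf hg .add

lemma sub (hf : Evaluable V f) (hg : Evaluable V g) : Evaluable V fun σ ↦ f σ - g σ :=
  arith hf hg .sub

lemma mul (hf : Evaluable V f) (hg : Evaluable V g) : Evaluable V fun σ ↦ f σ * g σ :=
  arith hf hg .mul

lemma ite_test {u v : Memory → ℝ} (hf : Evaluable V f) (hg : Evaluable V g) (hu : Evaluable V u)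
    (hv : Evaluable V v) {b : ℕ → ℕ → Test} {R : ℝ → ℝ → Prop}
    (hb : ∀ s x y, (b x y).Holds s ↔ R (s.reg x) (s.reg y)) [∀ σ, Decidable (R (f σ) (g σ))] :
    Evaluable V fun σ ↦ if R (f σ) (g σ) then u σ else v σ := by
  intro r hr
  obtain ⟨c, K, hc⟩ := exists_pair hf hg hr
  obtain ⟨c₁, K₁, h₁⟩ := hu r hr
  obtain ⟨c₂, K₂, h₂⟩ := hv r hr
  refine ⟨.seq c (.ite (b r (r + 1)) c₁ c₂), K + (max K₁ K₂ + 1), fun σ s hs ↦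
    (hc σ s hs).seq fun t ⟨hft, hgt, hst⟩ ↦ ?_⟩
  have ht := hs.of_agreesBelow hst hr
  have hR : (b r (r + 1)).Holds t ↔ R (f σ) (g σ) := by rw [hb, hft, hgt]
  refine HaltsWithin.ite (fun h ↦ (h₁ σ t ht).mono le_rfl fun u ⟨hut, htu⟩ ↦ ?_)
    (fun h ↦ (h₂ σ t ht).mono le_rfl fun u ⟨hvt, htu⟩ ↦ ?_)
  · exact ⟨hut.trans (if_pos (hR.1 h)).symm, hst.trans htu le_rfl⟩
  · exact ⟨hvt.trans (if_neg (mt hR.2 h)).symm, hst.trans htu le_rfl⟩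

lemma ite_lt {u v : Memory → ℝ} (hf : Evaluable V f) (hg : Evaluable V g) (hu : Evaluable V u)
    (hv : Evaluable V v) [∀ σ, Decidable (f σ < g σ)] :
    Evaluable V fun σ ↦ if f σ < g σ then u σ else v σ :=
  ite_test hf hg hu hv (b := .lt) (R := (· < ·)) fun _ _ _ ↦ Iff.rfl

lemma ite_eq {u v : Memory → ℝ} (hf : Evaluable V f) (hg : Evaluable V g) (hu : Evaluable V u)
    (hv : Evaluable V v) [∀ σ, Decidable (f σ = g σ)] :
    Evaluable V fun σ ↦ if f σ = g σ then u σ else v σ :=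
  ite_test hf hg hu hv (b := .eq) (R := (· = ·)) fun _ _ _ ↦ Iff.rfl

lemma sum {ι : Type*} (S : Finset ι) {F : ι → Memory → ℝ} (hF : ∀ i ∈ S, Evaluable V (F i)) :
    Evaluable V fun σ ↦ ∑ i ∈ S, F i σ := by
  simpa only [← Finset.sum_apply] using
    Finset.sum_induction F (Evaluable V) (fun _ _ ↦ add) (zero V) hF

lemma prod {ι : Type*} (S : Finset ι) {F : ι → Memory → ℝ} (hF : ∀ i ∈ S, Evaluable V (F i)) :
    Evaluable V fun σ ↦ ∏ i ∈ S, F i σ := by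
  simpa only [← Finset.prod_apply] using
    Finset.prod_induction F (Evaluable V) (fun _ _ ↦ mul) (one V) hF

lemma det {ι : Type*} [Fintype ι] [DecidableEq ι] {M : Memory → Matrix ι ι ℝ}
    (hM : ∀ i j, Evaluable V fun σ ↦ M σ i j) : Evaluable V fun σ ↦ (M σ).det := by
  simp only [Matrix.det_apply']
  exact sum _ fun π _ ↦ (intCast V _).mul (prod _ fun i _ ↦ hM _ _)

lemma adjugate {ι : Type*} [Fintype ι] [DecidableEq ι] {M : Memory → Matrix ι ι ℝ}
    (hM : ∀ i j, Evaluable V fun σ ↦ M σ i j) (i j : ι) :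
    Evaluable V fun σ ↦ (M σ).adjugate i j := by
  simp only [Matrix.adjugate_apply]
  refine det fun k e ↦ ?_
  rcases eq_or_ne k j with rfl | hk
  · simp only [Matrix.updateRow_self, Pi.single_apply]
    split
    exacts [one V, zero V]
  · simpa only [Matrix.updateRow_ne hk] using hM k e

lemma ite_zero_lt_toLex {n : ℕ} {v : Memory → Fin n → ℝ} (hv : ∀ k, Evaluable V fun σ ↦ v σ k)
    [∀ σ, Decidable (0 < toLex (v σ))] :
    Evaluable V fun σ ↦ if 0 < toLex (v σ) then 1 else 0 := by
  classical
  induction n with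
  | zero =>
    have h σ : ¬0 < toLex (v σ) := fun ⟨i, _⟩ ↦ i.elim0
    simpa only [h, if_false] using zero V
  | succ n ih =>
    have hsplit σ : (if 0 < toLex (v σ) then (1 : ℝ) else 0) =
        if 0 < v σ 0 then 1 else
          if v σ 0 = 0 then if 0 < toLex (Fin.tail (v σ)) then 1 else 0 else 0 := by
      simp only [zero_lt_toLex_iff]
      split_ifs <;> simp_all
    simp only [hsplit]
    exact ite_lt (zero V) (hv 0) (one V)
      (ite_eq (hv 0) (zero V) (ih fun k ↦ hv k.succ) (zero V))

lemma cellCoeff {d : ℕ} {M : Memory → Matrix (Fin d) (Fin d) ℝ} {c s a : Memory → Fin d → ℝ}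
    {γ : Memory → ℝ} (hM : ∀ i j, Evaluable V fun σ ↦ M σ i j)
    (hc : ∀ k, Evaluable V fun σ ↦ c σ k) (hs : ∀ k, Evaluable V fun σ ↦ s σ k)
    (ha : ∀ k, Evaluable V fun σ ↦ a σ k) (hγ : Evaluable V γ) (k : Fin (d + 1)) :
    Evaluable V fun σ ↦ _root_.cellCoeff (M σ) (c σ) (s σ) (a σ) (γ σ) k := by
  have hadj j : Evaluable V fun σ ↦ Matrix.vecMul (a σ) (M σ).adjugate j :=
    sum Finset.univ fun i _ ↦ (ha i).mul (adjugate hM i j)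
  refine Fin.cases ?_ (fun k ↦ ?_) k
  · exact (det hM).mul ((sum _ fun j _ ↦ (hadj j).mul (hc j)).sub (hγ.mul (det hM)))
  · exact (det hM).mul ((hadj k).mul (hs k))

lemma exists_assign (x : ℕ) {f : Memory → ℕ} (hf : Evaluable V fun σ ↦ (f σ : ℝ)) :
    ∃ c K, ∀ σ, Runs V c σ K (· = σ.setReg x (f σ)) := by
  obtain ⟨c, K, hc⟩ := hf V le_rfl
  refine ⟨.seq c (.copy x V), K + 1, fun σ s hs ↦ (hc σ s hs).seq fun t ⟨hval, hst⟩ ↦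
    .of_exec (.copy t x V) ⟨_, ?_, rfl⟩⟩
  rw [hval]
  exact (hs.of_agreesBelow hst le_rfl).setReg x _

lemma exists_store (a : ℕ) {i : Memory → ℕ} (hi : Evaluable V fun σ ↦ (i σ : ℝ))
    (hf : Evaluable V f) : ∃ c K, ∀ σ, Runs V c σ K (· = σ.setBank a (i σ) (f σ)) := by
  obtain ⟨c, K, hc⟩ := exists_pair hi hf le_rfl
  refine ⟨.seq c (.store a V (V + 1)), K + 1, fun σ s hs ↦ (hc σ s hs).seq
    fun t ⟨hit, hft, hst⟩ ↦ .of_exec (.store t a V (V + 1) (i σ) hit) ⟨_, ?_, rfl⟩⟩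
  rw [hft]
  exact (hs.of_agreesBelow hst le_rfl).setBank a _ _

end Evaluable

end Evaluable

section FlagData

/-!
Registers `0`, `1`, `2` hold `l`, `q` and the length of the list in bank `3`. Registers `4`, `5`,
`6` hold the bounds `l + d`, `q + 1`, `3` of the loops that enumerate the flags; hyperplane, point
and `1 +` sign of entry `k` of the current flag are in the registers `9 + 3 * k`, `10 + 3 * k`,
`11 + 3 * k`. Registers `7` and `8` are counters for points and rows, the registers from `9 + 3 * d`
on are scratch space. The index `q` for a point is admitted so that there are flags also if `q = 0`.
-/

variable (d : ℕ) (σ : Memory) (f : Fin d → ℕ × ℕ × ℕ)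

/-- Entry `e` of the `i`-th normal: the rows of `A`, followed by the unit vectors. -/
noncomputable def normal (i e : ℕ) : ℝ :=
  if i < σ.reg 0 then σ.bank 0 (i * d + e) else if i = σ.reg 0 + e then 1 else 0

/-- The number `A i ⬝ᵥ p j - b i`. -/
noncomputable def offset (i j : ℕ) : ℝ :=
  ∑ e ∈ Finset.range d, σ.bank 0 (i * d + e) * σ.bank 2 (j * d + e) - σ.bank 1 i

/-- The flag encoded in the registers: entry `k` consists of the index of a normal, the index of a
point, and `1 +` the sign of the displacement of the hyperplane these two determine. -/
def Memory.flag : Fin d → ℕ × ℕ × ℕ :=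
  fun k ↦ (σ.reg (9 + 3 * k), σ.reg (10 + 3 * k), σ.reg (11 + 3 * k))

/-- The matrix formed by the normals of the flag `f`. -/
noncomputable def flagMatrix : Matrix (Fin d) (Fin d) ℝ :=
  .of fun k e ↦ normal d σ (f k).1 e

/-- The vector whose lexicographic sign is the position of the cell of the flag `f` with respect to
the hyperplane `A i ⬝ᵥ t = A i ⬝ᵥ p j - b i`. -/
noncomputable def positionCoeff (i j : ℕ) : Fin (d + 1) → ℝ :=
  cellCoeff (flagMatrix d σ f) (fun k ↦ offset d σ (f k).1 (f k).2.1) (fun k ↦ (f k).2.2 - 1)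
    (fun e ↦ normal d σ i e) (offset d σ i j)

open Classical in
/-- `1` if the point `j` belongs to the translates of `W` given by the cell of `f`, else `0`. -/
noncomputable def selectionBit (j : ℕ) : ℝ :=
  ∏ i ∈ Finset.range (σ.reg 0), if 0 < toLex (positionCoeff d σ f i j) then 1 else 0

/-- The singleton of the set of indices of points selected by the flag `f`; empty if the normals of
`f` are dependent. -/
def flagFamily : Set (Set ℕ) :=
  {B | (flagMatrix d σ f).det ≠ 0 ∧
    B = {j | j < σ.reg 1 ∧ ∀ i < σ.reg 0, 0 < toLex (positionCoeff d σ f i j)}}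

variable {d σ f}

lemma selectionBit_eq_ite (j : ℕ)
    [Decidable (∀ i < σ.reg 0, 0 < toLex (positionCoeff d σ f i j))] :
    selectionBit d σ f j = if ∀ i < σ.reg 0, 0 < toLex (positionCoeff d σ f i j) then 1 else 0 := by
  classical
  rw [selectionBit, Finset.prod_boole]
  simp only [Finset.mem_range]

lemma selectionBit_eq_zero_or_one (j : ℕ) :
    selectionBit d σ f j = 0 ∨ selectionBit d σ f j = 1 := by
  classical
  rw [selectionBit_eq_ite]
  split_ifs <;> simp

lemma selectionBit_eq_one_iff {j : ℕ} :
    selectionBit d σ f j = 1 ↔ ∀ i < σ.reg 0, 0 < toLex (positionCoeff d σ f i j) := by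
  classical
  rw [selectionBit_eq_ite]
  split_ifs <;> simp_all

lemma flagMatrix_congr {τ : Memory} (hreg : τ.reg 0 = σ.reg 0) (hbank : ∀ a ≠ 3,
    τ.bank a = σ.bank a) : flagMatrix d τ = flagMatrix d σ := by
  funext f
  simp [flagMatrix, normal, hreg, hbank]

lemma positionCoeff_congr {τ : Memory} (hreg : τ.reg 0 = σ.reg 0) (hbank : ∀ a ≠ 3,
    τ.bank a = σ.bank a) : positionCoeff d τ = positionCoeff d σ := by
  funext f i j
  simp [positionCoeff, flagMatrix_congr hreg hbank, normal, offset, hreg, hbank]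

lemma selectionBit_congr {τ : Memory} (hreg : τ.reg 0 = σ.reg 0) (hbank : ∀ a ≠ 3,
    τ.bank a = σ.bank a) : selectionBit d τ = selectionBit d σ := by
  funext f j
  rw [selectionBit, positionCoeff_congr hreg hbank, hreg, selectionBit]

lemma flagFamily_congr {τ : Memory} (hreg₀ : τ.reg 0 = σ.reg 0) (hreg₁ : τ.reg 1 = σ.reg 1)
    (hbank : ∀ a ≠ 3, τ.bank a = σ.bank a) : flagFamily d τ = flagFamily d σ := by
  funext f
  rw [flagFamily, positionCoeff_congr hreg₀ hbank, flagMatrix_congr hreg₀ hbank, hreg₀, hreg₁,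
    flagFamily]

lemma flagFamily_of_det_eq_zero (h : (flagMatrix d σ f).det = 0) : flagFamily d σ f = ∅ := by
  simp [flagFamily, h]

lemma flagFamily_of_det_ne_zero (h : (flagMatrix d σ f).det ≠ 0) :
    flagFamily d σ f = {{j | j < σ.reg 1 ∧ selectionBit d σ f j = 1}} := by
  ext B
  simp [flagFamily, h, selectionBit_eq_one_iff]

lemma flag_congr {τ : Memory} (hreg : ∀ x ≥ 9, τ.reg x = σ.reg x) : τ.flag d = σ.flag d := by
  funext k
  simp only [Memory.flag]
  rw [hreg, hreg, hreg] <;> lia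

end FlagData

namespace Evaluable

variable {V d : ℕ} {i j : Memory → ℕ} {f : Memory → Fin d → ℕ × ℕ × ℕ}

lemma entry (hi : Evaluable V fun σ ↦ (i σ : ℝ)) (a d e : ℕ) :
    Evaluable V fun σ ↦ σ.bank a (i σ * d + e) := by
  refine bank (i := fun σ ↦ i σ * d + e) ?_ a
  push_cast
  exact (hi.mul (natCast V d)).add (natCast V e)

lemma normal (hV : 0 < V) (hi : Evaluable V fun σ ↦ (i σ : ℝ)) (d e : ℕ) :
    Evaluable V fun σ ↦ RealRAM.normal d σ (i σ) e := by
  have h := ite_lt hi (reg hV) (entry hi 0 d e)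
    (ite_eq hi ((reg hV).add (natCast V e)) (one V) (zero V))
  simp only [← Nat.cast_add, Nat.cast_lt, Nat.cast_inj] at h
  exact h

lemma offset (hi : Evaluable V fun σ ↦ (i σ : ℝ)) (hj : Evaluable V fun σ ↦ (j σ : ℝ)) (d : ℕ) :
    Evaluable V fun σ ↦ RealRAM.offset d σ (i σ) (j σ) :=
  (sum _ fun e _ ↦ (entry hi 0 d e).mul (entry hj 2 d e)).sub (bank hi 1)

lemma flagMatrix (hV : 0 < V) (hf : ∀ k, Evaluable V fun σ ↦ ((f σ k).1 : ℝ)) (k e : Fin d) :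
    Evaluable V fun σ ↦ RealRAM.flagMatrix d σ (f σ) k e :=
  normal hV (hf k) d e

lemma positionCoeff (hV : 0 < V) (hf₁ : ∀ k, Evaluable V fun σ ↦ ((f σ k).1 : ℝ))
    (hf₂ : ∀ k, Evaluable V fun σ ↦ ((f σ k).2.1 : ℝ))
    (hf₃ : ∀ k, Evaluable V fun σ ↦ ((f σ k).2.2 : ℝ))
    (hi : Evaluable V fun σ ↦ (i σ : ℝ)) (hj : Evaluable V fun σ ↦ (j σ : ℝ)) (k : Fin (d + 1)) :
    Evaluable V fun σ ↦ RealRAM.positionCoeff d σ (f σ) (i σ) (j σ) k :=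
  cellCoeff (flagMatrix hV hf₁) (fun k ↦ offset (hf₁ k) (hf₂ k) d) (fun k ↦ (hf₃ k).sub (one V))
    (fun e ↦ normal hV hi d e) (offset hi hj d) k

lemma flag_positionCoeff (d : ℕ) (k : Fin (d + 1)) : Evaluable (9 + 3 * d) fun σ ↦
    RealRAM.positionCoeff d σ (σ.flag d) (σ.reg 8) (σ.reg 7) k :=
  positionCoeff (by lia) (fun k ↦ reg (by lia)) (fun k ↦ reg (by lia)) (fun k ↦ reg (by lia))
    (reg (by lia)) (reg (by lia)) k

lemma ite_det_flagMatrix_eq_zero (d : ℕ) : Evaluable (9 + 3 * d) fun σ ↦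
    if (RealRAM.flagMatrix d σ (σ.flag d)).det = 0 then 0 else 1 :=
  ite_eq (det (flagMatrix (by lia) fun k ↦ reg (by lia))) (zero _) (zero _) (one _)

end Evaluable

section Emit

variable {d : ℕ}

lemma exists_writeBit (d : ℕ) : ∃ c K, ∀ σ : Memory, σ.reg 8 = 0 →
    Runs (9 + 3 * d) c σ (K * max (σ.reg 0) 1)
      (· = σ.setBank 3 (σ.reg 2 * σ.reg 1 + σ.reg 7) (selectionBit d σ (σ.flag d) (σ.reg 7))) := by
  classical
  have hcell : Evaluable (9 + 3 * d) fun σ ↦ ((σ.reg 2 * σ.reg 1 + σ.reg 7 : ℕ) : ℝ) := by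
    push_cast
    exact ((Evaluable.reg (by lia)).mul (.reg (by lia))).add (.reg (by lia))
  obtain ⟨c₁, K₁, h₁⟩ := Evaluable.exists_store 3 hcell (.one _)
  obtain ⟨c₂, K₂, h₂⟩ := Evaluable.exists_store 3 hcell
    ((Evaluable.bank hcell 3).mul (.ite_zero_lt_toLex (Evaluable.flag_positionCoeff d)))
  refine ⟨.seq c₁ (.forLoop (9 + 3 * d) 8 0 c₂), K₁ + (K₂ + 5), fun σ hσ ↦ ?_⟩
  let cell := σ.reg 2 * σ.reg 1 + σ.reg 7
  let bit (i : ℕ) : ℝ :=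
    if 0 < toLex (positionCoeff d σ (σ.flag d) i (σ.reg 7)) then 1 else 0
  have hloop := Runs.forLoop (V := 9 + 3 * d) (x := 8) (y := 0) (by lia) (by lia) (by lia)
    (c := c₂) (n := σ.reg 0) (K := K₂)
    (I := fun i τ ↦ τ = σ.setBank 3 cell (∏ i' ∈ Finset.range i, bit i'))
    (by rintro i _ rfl; exact ⟨hσ, rfl⟩) ?_ rfl
  · refine (Runs.seq (L := σ.reg 0 * (K₂ + 3) + 2) (h₁ σ) fun τ hτ ↦ ?_).mono ?_ fun _ ↦ id
    · rw [hτ]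
      simpa [selectionBit, cell, bit] using hloop
    · nlinarith [le_max_left (σ.reg 0) 1, le_max_right (σ.reg 0) 1]
  · rintro i - _ rfl
    refine (h₂ _).mono le_rfl ?_
    rintro _ rfl
    have hcoeff : positionCoeff d ((σ.setBank 3 cell (∏ i' ∈ Finset.range i, bit i')).setReg 8 i) =
        positionCoeff d σ := positionCoeff_congr rfl fun a ha ↦ by simp [ha]
    have hflag : ((σ.setBank 3 cell (∏ i' ∈ Finset.range i, bit i')).setReg 8 i).flag d =
        σ.flag d := flag_congr fun x hx ↦ by simp [show x ≠ 8 by lia]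
    refine ⟨by simp, ?_⟩
    simp only [hcoeff, hflag]
    ext x
    · by_cases hx : x = 8 <;> simp [hx, hσ]
    · simp [Finset.prod_range_succ, cell, bit]

lemma exists_writeRow (d : ℕ) : ∃ c K, ∀ σ : Memory, σ.reg 7 = 0 → σ.reg 8 = 0 →
    Runs (9 + 3 * d) c σ (K * (max (σ.reg 0) 1 * max (σ.reg 1) 1))
      (· = σ.setBlock 3 (σ.reg 2 * σ.reg 1) (σ.reg 1) (selectionBit d σ (σ.flag d))) := by
  obtain ⟨c, K, hc⟩ := exists_writeBit d
  refine ⟨.forLoop (9 + 3 * d) 7 1 c, K + 5, fun σ hσ₇ hσ₈ ↦ ?_⟩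
  refine (Runs.forLoop (V := 9 + 3 * d) (x := 7) (y := 1) (by lia) (by lia) (by lia)
    (c := c) (n := σ.reg 1) (K := K * max (σ.reg 0) 1)
    (I := fun n τ ↦ τ = σ.setBlock 3 (σ.reg 2 * σ.reg 1) n (selectionBit d σ (σ.flag d)))
    (by rintro n _ rfl; exact ⟨hσ₇, rfl⟩) ?_ (by simp)).mono ?_ fun _ ↦ id
  · rintro n - _ rfl
    set τ := (σ.setBlock 3 (σ.reg 2 * σ.reg 1) n (selectionBit d σ (σ.flag d))).setReg 7 n
    have hreg (x : ℕ) (hx : x ≠ 7) : τ.reg x = σ.reg x := by simp [τ, hx]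
    have hbit : selectionBit d τ (τ.flag d) = selectionBit d σ (σ.flag d) := by
      rw [selectionBit_congr (hreg 0 (by lia)) fun a ha ↦ by simp [τ, ha],
        flag_congr fun x hx ↦ hreg x (by lia)]
    refine (hc τ (by rw [hreg 8 (by lia), hσ₈])).mono (by rw [hreg 0 (by lia)]) ?_
    rintro _ rfl
    have hτ₇ : τ.reg 7 = n := by simp [τ]
    refine ⟨by simp [hτ₇], ?_⟩
    rw [hbit, hτ₇, hreg 1 (by lia), hreg 2 (by lia), ← Memory.setBank_setBlock]
    ext x
    · by_cases hx : x = 7 <;> simp [τ, hx, hσ₇]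
    · simp [τ]
  · have hl := le_max_right (σ.reg 0) 1
    have hq := le_max_right (σ.reg 1) 1
    have hsize : σ.reg 1 ≤ max (σ.reg 0) 1 * max (σ.reg 1) 1 := by
      nlinarith [le_max_left (σ.reg 1) 1]
    have hrow := Nat.mul_le_mul_left (K * max (σ.reg 0) 1) (le_max_left (σ.reg 1) 1)
    linarith [Nat.mul_le_mul hl hq]

open Classical in
/-- The content after the subset selected by the current flag has been appended to the list; it
remains outside the list if the normals of the flag are dependent. -/
noncomputable def Memory.emit (d : ℕ) (σ : Memory) : Memory :=
  (σ.setBlock 3 (σ.reg 2 * σ.reg 1) (σ.reg 1) (selectionBit d σ (σ.flag d))).setReg 2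
    (σ.reg 2 + if (flagMatrix d σ (σ.flag d)).det = 0 then 0 else 1)

lemma exists_emit (d : ℕ) : ∃ c K, ∀ σ : Memory, σ.reg 7 = 0 → σ.reg 8 = 0 →
    Runs (9 + 3 * d) c σ (K * (max (σ.reg 0) 1 * max (σ.reg 1) 1)) (· = σ.emit d) := by
  classical
  obtain ⟨c₁, K₁, h₁⟩ := exists_writeRow d
  have hlength : Evaluable (9 + 3 * d) fun σ ↦
      ((σ.reg 2 + if (flagMatrix d σ (σ.flag d)).det = 0 then 0 else 1 : ℕ) : ℝ) := by
    push_cast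
    exact (Evaluable.reg (by lia)).add (.ite_det_flagMatrix_eq_zero d)
  obtain ⟨c₂, K₂, h₂⟩ := Evaluable.exists_assign 2 hlength
  refine ⟨.seq c₁ c₂, K₁ + K₂, fun σ hσ₇ hσ₈ ↦ ?_⟩
  refine ((h₁ σ hσ₇ hσ₈).seq fun τ hτ ↦ (h₂ τ).mono le_rfl ?_).mono ?_ fun _ ↦ id
  · rintro _ rfl
    have hmatrix : flagMatrix d τ (τ.flag d) = flagMatrix d σ (σ.flag d) := by
      subst hτ
      exact congrFun (flagMatrix_congr rfl fun a ha ↦ by simp [ha]) _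
    rw [hmatrix, hτ]
    rfl
  · have hl := le_max_right (σ.reg 0) 1
    have hq := le_max_right (σ.reg 1) 1
    nlinarith [Nat.mul_le_mul hl hq]

end Emit

section Listing

/-- The family of the subsets of `{0, …, n - 1}` whose incidence vectors form the list of length `m`
in the bank `v`. -/
def listedFamily (v : ℕ → ℝ) (n m : ℕ) : Set (Set ℕ) :=
  {B | ∃ r < m, B = {j | j < n ∧ v (r * n + j) = 1}}

/-- The content `σ` differs from `σ₀` only by a list of incidence vectors, which lists `F`. -/
structure Listing (σ₀ : Memory) (F : Set (Set ℕ)) (σ : Memory) : Prop where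
  reg : ∀ x ≠ 2, σ.reg x = σ₀.reg x
  bank : ∀ a ≠ 3, σ.bank a = σ₀.bank a
  bit : ∀ k < σ.reg 2 * σ.reg 1, σ.bank 3 k = 0 ∨ σ.bank 3 k = 1
  family : listedFamily (σ.bank 3) (σ.reg 1) (σ.reg 2) = F

variable {d : ℕ} {σ₀ σ : Memory} {F : Set (Set ℕ)}

lemma Listing.setReg (h : Listing σ₀ F σ) {x : ℕ} (hx : 2 < x) (v : ℕ) :
    Listing (σ₀.setReg x v) F (σ.setReg x v) where
  reg y hy := by
    rcases eq_or_ne y x with rfl | hyx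
    · simp
    · simp [hyx, h.reg y hy]
  bank := h.bank
  bit := by simpa [hx.ne, (show 1 ≠ x by lia)] using h.bit
  family := by simpa [hx.ne, (show 1 ≠ x by lia)] using h.family

lemma listedFamily_congr {v w : ℕ → ℝ} {n m : ℕ} (h : ∀ k < m * n, v k = w k) :
    listedFamily v n m = listedFamily w n m := by
  have hrow {r : ℕ} (hr : r < m) : {j | j < n ∧ v (r * n + j) = 1} =
      {j | j < n ∧ w (r * n + j) = 1} := by
    ext j
    refine and_congr_right fun hj ↦ ?_
    rw [h _ (by nlinarith)]
  ext B
  exact exists_congr fun r ↦ and_congr_right fun hr ↦ by rw [hrow hr]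

lemma listedFamily_succ {v w : ℕ → ℝ} {n m : ℕ} (h : ∀ j < n, v (m * n + j) = w j) :
    listedFamily v n (m + 1) = listedFamily v n m ∪ {{j | j < n ∧ w j = 1}} := by
  have hrow : {j | j < n ∧ v (m * n + j) = 1} = {j | j < n ∧ w j = 1} := by
    ext j
    exact and_congr_right fun hj ↦ by rw [h j hj]
  ext B
  simp [listedFamily, Nat.le_iff_lt_or_eq, or_and_right, exists_or, or_comm, hrow]

lemma Listing.emit (h : Listing σ₀ F σ) :
    Listing σ₀ (F ∪ flagFamily d σ₀ (σ₀.flag d)) (σ.emit d) := by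
  classical
  set m := σ.reg 2 with hm
  set q := σ.reg 1 with hq
  have hflag : σ.flag d = σ₀.flag d := flag_congr fun x hx ↦ h.reg x (by lia)
  have hmatrix : flagMatrix d σ = flagMatrix d σ₀ := flagMatrix_congr (h.reg 0 (by lia)) h.bank
  have hbits : selectionBit d σ = selectionBit d σ₀ := selectionBit_congr (h.reg 0 (by lia)) h.bank
  have hold {k : ℕ} (hk : k < m * q) : (σ.emit d).bank 3 k = σ.bank 3 k := by
    simp [Memory.emit, ← hm, ← hq, hk.not_ge]
  have hnew {j : ℕ} (hj : j < q) :
      (σ.emit d).bank 3 (m * q + j) = selectionBit d σ₀ (σ₀.flag d) j := by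
    simp [Memory.emit, ← hm, ← hq, hj, hflag, hbits]
  have hlength : (σ.emit d).reg 2 =
      m + if (flagMatrix d σ₀ (σ₀.flag d)).det = 0 then 0 else 1 := by
    simp [Memory.emit, ← hm, hflag, hmatrix]
  have hwidth : (σ.emit d).reg 1 = q := by simp [Memory.emit, hq]
  refine ⟨fun x hx ↦ by simp [Memory.emit, hx, h.reg], fun a ha ↦ by simp [Memory.emit, ha, h.bank],
    fun k hk ↦ ?_, ?_⟩
  · have hk' : k < m * q + q := by
      rw [hlength, hwidth] at hk
      split_ifs at hk <;> lia
    obtain hkm | ⟨j, rfl⟩ := lt_or_ge k (m * q) |>.imp_right Nat.exists_eq_add_of_le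
    · exact hold hkm ▸ h.bit k hkm
    · exact hnew (j := j) (by lia) ▸ selectionBit_eq_zero_or_one j
  · rw [hlength, hwidth, ← h.family]
    split_ifs with hdet
    · rw [add_zero, listedFamily_congr fun k ↦ hold, flagFamily_of_det_eq_zero hdet,
        Set.union_empty]
    · rw [listedFamily_succ fun j ↦ hnew, listedFamily_congr fun k ↦ hold,
        flagFamily_of_det_ne_zero hdet, hq, h.reg 1 (by lia)]

end Listing

section Nest

/-- Execute `c` for all values of the counters in the registers `9, …, 9 + k - 1`, which are bounded
in turn by the registers `4`, `5`, `6`. -/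
def Program.nest (V : ℕ) (c : Program) : ℕ → Program
  | 0 => c
  | k + 1 => .forLoop V (9 + k) (4 + k % 3) (nest V c k)

/-- Overwrite the registers `9, …, 9 + k - 1`, the counters of `Program.nest`. -/
def Memory.setCounters (σ : Memory) (k : ℕ) (n : ℕ → ℕ) : Memory :=
  { σ with reg := fun x ↦ if 9 ≤ x ∧ x < 9 + k then n (x - 9) else σ.reg x }

/-- The union of the families `G` over all values the counters take during `Program.nest`. -/
def nestFamily (G : Memory → Set (Set ℕ)) (σ : Memory) (k : ℕ) : Set (Set ℕ) :=
  {B | ∃ n : ℕ → ℕ, (∀ z < k, n z < σ.reg (4 + z % 3)) ∧ B ∈ G (σ.setCounters k n)}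

variable {d V K : ℕ} {c : Program} {F : Set (Set ℕ)} {G : Memory → Set (Set ℕ)} {σ₀ σ : Memory}

lemma nestFamily_zero (G : Memory → Set (Set ℕ)) (σ : Memory) : nestFamily G σ 0 = G σ := by
  have h (n : ℕ → ℕ) : σ.setCounters 0 n = σ := by
    ext x
    · simp [Memory.setCounters, (show ¬(9 ≤ x ∧ x < 9) by lia)]
    · rfl
  ext B
  simp [nestFamily, h]

lemma setCounters_succ (σ : Memory) (k i : ℕ) (n : ℕ → ℕ) :
    σ.setCounters (k + 1) (Function.update n k i) = (σ.setReg (9 + k) i).setCounters k n := by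
  ext x
  · simp only [Memory.setCounters, Memory.reg_setReg, Function.update_apply]
    grind
  · rfl

lemma nestFamily_succ (G : Memory → Set (Set ℕ)) (σ : Memory) (k : ℕ) :
    nestFamily G σ (k + 1) = ⋃ i < σ.reg (4 + k % 3), nestFamily G (σ.setReg (9 + k) i) k := by
  have hbound (i z : ℕ) : (σ.setReg (9 + k) i).reg (4 + z % 3) = σ.reg (4 + z % 3) := by
    simp [(show 4 + z % 3 ≠ 9 + k by lia)]
  ext B
  simp only [nestFamily, Set.mem_ofPred_eq, Set.mem_iUnion, exists_prop, hbound]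
  constructor
  · rintro ⟨n, hn, hB⟩
    refine ⟨n k, hn k (by lia), n, fun z hz ↦ hn z (by lia), ?_⟩
    rwa [← setCounters_succ, Function.update_eq_self]
  · rintro ⟨i, hi, n, hn, hB⟩
    refine ⟨Function.update n k i, fun z hz ↦ ?_, by rwa [setCounters_succ]⟩
    rcases eq_or_ne z k with rfl | hzk
    · simpa using hi
    · simpa [hzk] using hn z (by lia)

lemma Runs.nest {b : ℕ → ℕ} (hc : ∀ σ₀ F σ, (∀ x < 9, σ₀.reg x = b x) → Listing σ₀ F σ →
      Runs V c σ K (Listing σ₀ (F ∪ G σ₀)))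
    (k : ℕ) (hk : 9 + k ≤ V) (hb : ∀ x < 9, σ₀.reg x = b x)
    (hcounter : ∀ x ≥ 9, x < 9 + k → σ₀.reg x = 0) (h : Listing σ₀ F σ) :
    Runs V (c.nest V k) σ ((∏ z ∈ Finset.range k, (b (4 + z % 3) + 1)) * (K + 5 * k))
      (Listing σ₀ (F ∪ nestFamily G σ₀ k)) := by
  induction k generalizing σ₀ F σ with
  | zero => simpa [nestFamily_zero, Program.nest] using hc σ₀ F σ hb h
  | succ k ih =>
    set N := ∏ z ∈ Finset.range k, (b (4 + z % 3) + 1) with hN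
    refine (Runs.forLoop (x := 9 + k) (y := 4 + k % 3) (by lia) (by lia) (by lia)
      (n := b (4 + k % 3)) (K := N * (K + 5 * k))
      (I := fun i ↦ Listing σ₀ (F ∪ ⋃ i' < i, nestFamily G (σ₀.setReg (9 + k) i') k))
      ?_ ?_ (by simpa using h)).mono ?_ fun τ hτ ↦ ?_
    · intro i τ hτ
      exact ⟨by rw [hτ.reg _ (by lia), hcounter _ (by lia) (by lia)],
        by rw [hτ.reg _ (by lia), hb _ (by lia)]⟩
    · intro i _ τ hτ
      refine (ih (by lia) (fun x hx ↦ ?_) (fun x hx₉ hxk ↦ ?_)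
        (hτ.setReg (x := 9 + k) (by lia) i)).mono le_rfl fun υ hυ ↦ ?_
      · simp [(show x ≠ 9 + k by lia), hb x hx]
      · simp [(show x ≠ 9 + k by lia), hcounter x hx₉ (by lia)]
      · refine ⟨by simpa using hυ.reg (9 + k) (by lia), ?_⟩
        have hreset := hυ.setReg (x := 9 + k) (by lia) 0
        rw [Memory.setReg_setReg, Memory.setReg_eq_self (hcounter (9 + k) (by lia) (by lia)),
          Set.union_assoc] at hreset
        simpa [Nat.le_iff_lt_or_eq, Set.iUnion_or, Set.iUnion_union_distrib] using hreset
    · have hN₁ : 1 ≤ N := Finset.prod_pos fun _ _ ↦ Nat.succ_pos _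
      rw [Finset.prod_range_succ, ← hN]
      nlinarith [Nat.zero_le (b (4 + k % 3))]
    · rwa [nestFamily_succ, hb _ (by lia)]

lemma prod_range_mul_three {M : Type*} [CommMonoid M] (f : ℕ → M) (d : ℕ) :
    ∏ z ∈ Finset.range (3 * d), f (z % 3) = (f 0 * f 1 * f 2) ^ d := by
  induction d with
  | zero => simp
  | succ d ih =>
    rw [show 3 * (d + 1) = 3 * d + 1 + 1 + 1 by ring, Finset.prod_range_succ,
      Finset.prod_range_succ, Finset.prod_range_succ, ih, pow_succ]
    simp [Nat.add_mod, mul_assoc]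

/-- The sets selected by the flags whose entries are below the bounds in the registers `4`, `5`,
`6`. -/
def flagsFamily (d : ℕ) (σ : Memory) : Set (Set ℕ) :=
  {B | ∃ f : Fin d → ℕ × ℕ × ℕ, (∀ k, (f k).1 < σ.reg 4 ∧ (f k).2.1 < σ.reg 5 ∧
    (f k).2.2 < σ.reg 6) ∧ B ∈ flagFamily d σ f}

lemma nestFamily_flagFamily (σ : Memory) :
    nestFamily (fun σ ↦ flagFamily d σ (σ.flag d)) σ (3 * d) = flagsFamily d σ := by
  have hflag (n : ℕ → ℕ) : (σ.setCounters (3 * d) n).flag d =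
      fun k : Fin d ↦ (n (3 * k), n (3 * k + 1), n (3 * k + 2)) := by
    funext k
    have hk := k.isLt
    simp only [Memory.flag, Memory.setCounters, Prod.mk.injEq]
    grind
  have hfamily (n : ℕ → ℕ) : flagFamily d (σ.setCounters (3 * d) n) = flagFamily d σ :=
    flagFamily_congr (by simp [Memory.setCounters]) (by simp [Memory.setCounters]) fun _ _ ↦ rfl
  ext B
  simp only [nestFamily, flagsFamily, Set.mem_ofPred_eq, hflag, hfamily]
  constructor
  · rintro ⟨n, hn, hB⟩
    refine ⟨_, fun k ↦ ⟨?_, ?_, ?_⟩, hB⟩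
    · simpa using hn (3 * k) (by lia)
    · simpa [Nat.add_mod] using hn (3 * k + 1) (by lia)
    · simpa [Nat.add_mod] using hn (3 * k + 2) (by lia)
  · rintro ⟨f, hf, hB⟩
    let entry (v : ℕ × ℕ × ℕ) (r : ℕ) : ℕ := if r = 0 then v.1 else if r = 1 then v.2.1 else v.2.2
    refine ⟨fun z ↦ if hz : z / 3 < d then entry (f ⟨z / 3, hz⟩) (z % 3) else 0,
      fun z hz ↦ ?_, ?_⟩
    · have hz' : z / 3 < d := by lia
      have hmod : z % 3 < 3 := by lia
      obtain ⟨h₁, h₂, h₃⟩ := hf ⟨z / 3, hz'⟩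
      simp only [hz', dif_pos]
      interval_cases z % 3 <;> simpa [entry]
    · convert hB with k <;> simp [entry, Nat.add_mod, Nat.mul_add_div]

lemma exists_listFlags (d : ℕ) : ∃ c K, ∀ σ : Memory, σ.reg 2 = 0 →
    (∀ x ≥ 7, x < 9 + 3 * d → σ.reg x = 0) →
    Runs (9 + 3 * d) c σ (((σ.reg 4 + 1) * (σ.reg 5 + 1) * (σ.reg 6 + 1)) ^ d *
      (K * (max (σ.reg 0) 1 * max (σ.reg 1) 1))) (Listing σ (flagsFamily d σ)) := by
  obtain ⟨c, K, hc⟩ := exists_emit d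
  refine ⟨c.nest (9 + 3 * d) (3 * d), K + 5 * (3 * d), fun σ hσ₂ hσ ↦ ?_⟩
  have hbody (σ₀ F τ) (hreg : ∀ x < 9, σ₀.reg x = σ.reg x) (hτ : Listing σ₀ F τ) :
      Runs (9 + 3 * d) c τ (K * (max (σ.reg 0) 1 * max (σ.reg 1) 1))
        (Listing σ₀ (F ∪ flagFamily d σ₀ (σ₀.flag d))) := by
    have hτreg (x : ℕ) (hx : x < 9) (hx₂ : x ≠ 2) : τ.reg x = σ.reg x :=
      (hτ.reg x hx₂).trans (hreg x hx)
    refine (hc τ ?_ ?_).mono ?_ ?_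
    · rw [hτreg 7 (by lia) (by lia), hσ 7 (by lia) (by lia)]
    · rw [hτreg 8 (by lia) (by lia), hσ 8 (by lia) (by lia)]
    · rw [hτreg 0 (by lia) (by lia), hτreg 1 (by lia) (by lia)]
    · rintro _ rfl
      exact hτ.emit
  have hstart : Listing σ ∅ σ :=
    ⟨fun _ _ ↦ rfl, fun _ _ ↦ rfl, by simp [hσ₂], by simp [listedFamily, hσ₂]⟩
  refine (Runs.nest hbody (3 * d) le_rfl (fun _ _ ↦ rfl) (fun x hx ↦ hσ x (by lia))
    hstart).mono ?_ fun τ hτ ↦ ?_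
  · rw [prod_range_mul_three fun r ↦ σ.reg (4 + r) + 1]
    gcongr
    have hl := le_max_right (σ.reg 0) 1
    have hq := le_max_right (σ.reg 1) 1
    nlinarith [Nat.mul_le_mul hl hq]
  · rwa [nestFamily_flagFamily, Set.empty_union] at hτ

end Nest

section Correctness

variable {l d q : ℕ} {σ : Memory}

lemma dotProduct_normal_unit (σ : Memory) (e : Fin d) (x : Fin d → ℝ) :
    (fun e' : Fin d ↦ normal d σ (σ.reg 0 + e) e') ⬝ᵥ x = x e := by
  simp [normal, dotProduct, Fin.val_inj]

lemma mem_flagsFamily (h₄ : σ.reg 4 = σ.reg 0 + d) (h₅ : σ.reg 5 = σ.reg 1 + 1)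
    (h₆ : σ.reg 6 = 3) (t : Fin d → ℝ) :
    {j | j < σ.reg 1 ∧ ∀ i < σ.reg 0, offset d σ i j < (fun e : Fin d ↦ normal d σ i e) ⬝ᵥ t} ∈
      flagsFamily d σ := by
  let a (x : Fin (σ.reg 0 + d) × Fin (σ.reg 1 + 1)) (e : Fin d) : ℝ := normal d σ x.1 e
  have ha (x : Fin d → ℝ) (hx : ∀ i, a i ⬝ᵥ x = 0) : x = 0 := by
    ext e
    rw [← dotProduct_normal_unit σ e x]
    exact hx (Fin.natAdd _ e, 0)
  obtain ⟨w, s, hdet, hpos⟩ :=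
    exists_flag_cellCoeff_pos_iff ha (fun x ↦ offset d σ x.1 x.2) t
  have hsign (k : Fin d) : (((s k : ℤ) + 1).toNat : ℝ) - 1 = s k := by
    cases s k <;> norm_num [show Int.toNat 2 = 2 from rfl]
  let f (k : Fin d) : ℕ × ℕ × ℕ := ((w k).1, (w k).2, ((s k : ℤ) + 1).toNat)
  refine ⟨f, fun k ↦ ⟨?_, ?_, ?_⟩, hdet, ?_⟩
  · rw [h₄]
    exact (w k).1.isLt
  · rw [h₅]
    exact (w k).2.isLt
  · rw [h₆]
    cases hs : s k <;> simp [f, hs]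
  · ext j
    refine and_congr_right fun hj ↦ forall₂_congr fun i hi ↦ ?_
    have h := hpos (⟨i, by lia⟩, ⟨j, by lia⟩)
    simp only [← hsign] at h
    exact h.symm

lemma flagsFamily_eq (h₄ : σ.reg 4 = σ.reg 0 + d) (h₅ : σ.reg 5 = σ.reg 1 + 1)
    (h₆ : σ.reg 6 = 3) : flagsFamily d σ = Set.range fun t : Fin d → ℝ ↦
      {j | j < σ.reg 1 ∧
        ∀ i < σ.reg 0, offset d σ i j < (fun e : Fin d ↦ normal d σ i e) ⬝ᵥ t} := by
  refine subset_antisymm ?_ (Set.range_subset_iff.2 (mem_flagsFamily h₄ h₅ h₆))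
  rintro _ ⟨f, -, hdet, rfl⟩
  obtain ⟨t, ht⟩ := exists_point_cellCoeff_pos_iff hdet
    (fun k ↦ offset d σ (f k).1 (f k).2.1) (fun k ↦ (f k).2.2 - 1)
    (fun (x : Fin (σ.reg 0) × Fin (σ.reg 1)) e ↦ normal d σ x.1 e) fun x ↦ offset d σ x.1 x.2
  refine ⟨t, ?_⟩
  ext j
  exact and_congr_right fun hj ↦ forall₂_congr fun i hi ↦ (ht (⟨i, hi⟩, ⟨j, hj⟩)).symm

lemma matBank_apply {m n : ℕ} (M : Fin m → Fin n → ℝ) (i : Fin m) (e : Fin n) :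
    matBank M (i * n + e) = M i e := by
  have h : (i : ℕ) * n + e < m * n := by nlinarith [i.isLt, e.isLt]
  rw [matBank, dif_pos h]
  congr 1 <;> ext
  · simp [Fin.divNat, mul_comm _ n, Nat.mul_add_div e.pos, Nat.div_eq_of_lt e.isLt]
  · simp [Fin.modNat, Nat.mod_eq_of_lt e.isLt]

lemma vecBank_apply {m : ℕ} (v : Fin m → ℝ) (i : Fin m) : vecBank v i = v i := by
  simp [vecBank]

/-- The content of the storage for the input `A`, `b`, `p`. -/
def inputMemory (A : Matrix (Fin l) (Fin d) ℝ) (b : Fin l → ℝ) (p : Fin q → Fin d → ℝ) :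
    Memory where
  reg x := match x with
    | 0 => l
    | 1 => q
    | _ => 0
  bank := (sepInput A b p).bank

/-- Store the bounds for the enumeration of the flags. -/
def Memory.setBounds (d : ℕ) (σ : Memory) : Memory :=
  ((σ.setReg 4 (σ.reg 0 + d)).setReg 5 (σ.reg 1 + 1)).setReg 6 3

/-- The content of the storage before the enumeration of the flags. -/
def flagsInput (A : Matrix (Fin l) (Fin d) ℝ) (b : Fin l → ℝ) (p : Fin q → Fin d → ℝ) : Memory :=
  (inputMemory A b p).setBounds d

variable (A : Matrix (Fin l) (Fin d) ℝ) (b : Fin l → ℝ) (p : Fin q → Fin d → ℝ)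

lemma normal_flagsInput (i : Fin l) (e : Fin d) : normal d (flagsInput A b p) i e = A i e :=
  (if_pos i.isLt).trans (matBank_apply A i e)

lemma offset_flagsInput (i : Fin l) (j : Fin q) :
    offset d (flagsInput A b p) i j = A i ⬝ᵥ p j - b i := by
  rw [offset, Finset.sum_range, dotProduct]
  congr 1
  · exact Finset.sum_congr rfl fun e _ ↦
      congrArg₂ (· * ·) (matBank_apply A i e) (matBank_apply p j e)
  · exact vecBank_apply b i

/-- The points with indices in `B`. -/
def pointsAt (B : Set ℕ) : Set (Fin d → ℝ) :=
  {x | ∃ j : Fin q, p j = x ∧ ↑j ∈ B}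

lemma sepFamily_openPolyhedron_range :
    SepFamily (openPolyhedron A b) (Set.range p) =
      pointsAt p '' flagsFamily d (flagsInput A b p) := by
  have hpart (t : Fin d → ℝ) : sepPart (openPolyhedron A b) (Set.range p) t =
      pointsAt p {j | j < q ∧ ∀ i < l, offset d (flagsInput A b p) i j <
        (fun e : Fin d ↦ normal d (flagsInput A b p) i e) ⬝ᵥ t} := by
    ext x
    rw [mem_sepPart_openPolyhedron, Set.mem_range, ← exists_and_right]
    refine exists_congr fun j ↦ and_congr_right ?_
    rintro rfl
    simp only [Set.mem_ofPred_eq, j.isLt, true_and]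
    exact Fin.forall_iff.trans <| forall₂_congr fun i hi ↦ by
      rw [← offset_flagsInput A b p ⟨i, hi⟩ j, ← funext (normal_flagsInput A b p ⟨i, hi⟩)]
  rw [flagsFamily_eq rfl rfl rfl, ← Set.range_comp]
  ext S
  exact exists_congr fun t ↦ by rw [hpart, eq_comm]; rfl

lemma image_pointsAt_listedFamily (v : ℕ → ℝ) (m : ℕ) : pointsAt p '' listedFamily v q m =
    {S | ∃ r < m, S = {x | ∃ j : Fin q, p j = x ∧ v (r * q + j) = 1}} := by
  have hrow (r : ℕ) : pointsAt p {j | j < q ∧ v (r * q + j) = 1} =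
      {x | ∃ j : Fin q, p j = x ∧ v (r * q + j) = 1} := by
    simp [pointsAt]
  ext S
  constructor
  · rintro ⟨_, ⟨r, hr, rfl⟩, rfl⟩
    exact ⟨r, hr, hrow r⟩
  · rintro ⟨r, hr, rfl⟩
    exact ⟨_, ⟨r, hr, rfl⟩, hrow r⟩

lemma displays_of_listing {τ : Memory} {V : ℕ} {s : State} {F : Set (Set ℕ)}
    (hτ : Listing (flagsInput A b p) F τ) (hV : 0 < V)
    (hs : (τ.setReg 0 (τ.reg 2)).StoredIn V s) : Displays s p (pointsAt p '' F) := by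
  have hwidth : τ.reg 1 = q := hτ.reg 1 (by lia)
  refine ⟨τ.reg 2, by simpa using hs.1 0 hV, fun r hr j ↦ ?_, ?_⟩
  · rw [hs.2]
    exact hτ.bit _ (by rw [hwidth]; nlinarith [j.isLt])
  · rw [← hτ.family, hwidth, image_pointsAt_listedFamily, hs.2]
    rfl

end Correctness

section Separate

lemma exists_computeBounds (d : ℕ) : ∃ c K, ∀ σ : Memory, Runs (9 + 3 * d) c σ K
    (· = σ.setBounds d) := by
  obtain ⟨c₁, K₁, h₁⟩ := Evaluable.exists_assign (V := 9 + 3 * d) (f := fun σ ↦ σ.reg 0 + d) 4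
    (by push_cast; exact (Evaluable.reg (by lia)).add (.natCast _ d))
  obtain ⟨c₂, K₂, h₂⟩ := Evaluable.exists_assign (V := 9 + 3 * d) (f := fun σ ↦ σ.reg 1 + 1) 5
    (by push_cast; exact (Evaluable.reg (by lia)).add (.one _))
  obtain ⟨c₃, K₃, h₃⟩ := Evaluable.exists_assign (f := fun _ ↦ 3) 6 (.natCast (9 + 3 * d) 3)
  refine ⟨.seq c₁ (.seq c₂ c₃), K₁ + (K₂ + K₃), fun σ ↦ ?_⟩
  refine (h₁ σ).seq ?_
  rintro _ rfl
  refine (h₂ _).seq ?_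
  rintro _ rfl
  exact h₃ _

lemma flag_bounds_le (d l q : ℕ) : (l + d + 1) * (q + 1 + 1) * (3 + 1) ≤
    12 * (d + 2) * (max l 1 * max q 1) := by
  have hl : l + d + 1 ≤ (d + 2) * max l 1 := by
    nlinarith [le_max_left l 1, le_max_right l 1]
  have hq : q + 1 + 1 ≤ 3 * max q 1 := by lia
  nlinarith [Nat.mul_le_mul hl hq]

lemma runtime_le (d l q K₁ K₂ K₃ : ℕ) :
    K₁ + (((l + d + 1) * (q + 1 + 1) * (3 + 1)) ^ d * (K₂ * (max l 1 * max q 1)) + K₃) ≤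
      (K₁ + (12 * (d + 2)) ^ d * K₂ + K₃) * (max l 1 * max q 1) ^ (d + 1) := by
  have hbounds := Nat.pow_le_pow_left (flag_bounds_le d l q) d
  set N := max l 1 * max q 1
  have hN : 1 ≤ N ^ (d + 1) := Nat.one_le_pow _ _ (by positivity)
  calc K₁ + (((l + d + 1) * (q + 1 + 1) * (3 + 1)) ^ d * (K₂ * N) + K₃)
      ≤ K₁ * N ^ (d + 1) + ((12 * (d + 2) * N) ^ d * (K₂ * N) + K₃ * N ^ (d + 1)) := by
        gcongr <;> exact Nat.le_mul_of_pos_right _ hN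
    _ = (K₁ + (12 * (d + 2)) ^ d * K₂ + K₃) * N ^ (d + 1) := by
        rw [mul_pow (12 * (d + 2)) N]
        ring

lemma storedIn_sepInput {l d q : ℕ} (A : Matrix (Fin l) (Fin d) ℝ) (b : Fin l → ℝ)
    (p : Fin q → Fin d → ℝ) (V : ℕ) : (inputMemory A b p).StoredIn V (sepInput A b p) := by
  refine ⟨fun x _ ↦ ?_, rfl⟩
  simp only [sepInput, inputMemory]
  split <;> simp

theorem exists_computesWithin_sepFamily (d : ℕ) : ∃ (c : Program) (C : ℕ), ∀ (l q : ℕ)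
    (A : Matrix (Fin l) (Fin d) ℝ) (b : Fin l → ℝ) (p : Fin q → Fin d → ℝ),
    ComputesWithin c A b p (SepFamily (openPolyhedron A b) (Set.range p))
      (C * (max l 1 * max q 1) ^ (d + 1)) := by
  obtain ⟨c₁, K₁, h₁⟩ := exists_computeBounds d
  obtain ⟨c₂, K₂, h₂⟩ := exists_listFlags d
  obtain ⟨c₃, K₃, h₃⟩ := Evaluable.exists_assign (f := fun σ ↦ σ.reg 2) 0
    (Evaluable.reg (V := 9 + 3 * d) (by lia))
  refine ⟨.seq c₁ (.seq c₂ c₃), K₁ + (12 * (d + 2)) ^ d * K₂ + K₃, fun l q A b p ↦ ?_⟩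
  have hzero (x : ℕ) (hx : x ≥ 7) : (flagsInput A b p).reg x = 0 := by
    simp only [flagsInput, Memory.setBounds, inputMemory, Memory.reg_setReg]
    grind
  have hlist : Runs (9 + 3 * d) (.seq c₂ c₃) (flagsInput A b p) _ fun σ ↦
      ∃ τ, Listing (flagsInput A b p) (flagsFamily d (flagsInput A b p)) τ ∧
        σ = τ.setReg 0 (τ.reg 2) :=
    (h₂ (flagsInput A b p) rfl fun x hx _ ↦ hzero x hx).seq fun τ hτ ↦
      (h₃ τ).mono le_rfl fun _ hσ ↦ ⟨τ, hτ, hσ⟩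
  obtain ⟨s, n, hexec, hn, _, hs, τ, hτ, rfl⟩ :=
    (h₁ (inputMemory A b p)).seq (by rintro _ rfl; exact hlist) _ (storedIn_sepInput A b p _)
  refine ⟨s, n, hexec, hn.trans ?_, ?_⟩
  · exact runtime_le d l q K₁ K₂ K₃
  · rw [sepFamily_openPolyhedron_range]
    exact displays_of_listing A b p hτ (by lia) hs

end Separate

end RealRAM

/-- For every fixed dimension `d` there is one real RAM program that computes `Sep_W(P)`:
within `C * (l q)^(d+1)` operations, `C` depending on `d` only; hence within
`C_W * card(P)^(d+1)` operations for fixed `W`, where `W` is an open polyhedron, or the interior of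
an intersection of finitely many closed halfspaces. (A factor `0` in a bound is replaced by `1`.) -/
theorem theorem2 (d : ℕ) (hd : 1 ≤ d) :
    ∃ c : RealRAM.Program,
      (∃ C : ℕ, ∀ (l : ℕ) (A : Matrix (Fin l) (Fin d) ℝ) (b : Fin l → ℝ)
        (P : Finset (Fin d → ℝ)) (p : Fin P.card ≃ P),
        RealRAM.ComputesWithin c A b (fun j => (p j : Fin d → ℝ))
          (SepFamily (openPolyhedron A b) (P : Set (Fin d → ℝ)))
          (C * (max l 1 * max P.card 1) ^ (d + 1))) ∧
      (∀ (l : ℕ) (A : Matrix (Fin l) (Fin d) ℝ) (b : Fin l → ℝ),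
        ∃ C : ℕ, ∀ (P : Finset (Fin d → ℝ)) (p : Fin P.card ≃ P),
        RealRAM.ComputesWithin c A b (fun j => (p j : Fin d → ℝ))
          (SepFamily (openPolyhedron A b) (P : Set (Fin d → ℝ)))
          (C * (max P.card 1) ^ (d + 1))) ∧
      (∀ (l : ℕ) (A : Matrix (Fin l) (Fin d) ℝ) (b : Fin l → ℝ), (∀ i, A i ≠ 0) →
        ∃ C : ℕ, ∀ (P : Finset (Fin d → ℝ)) (p : Fin P.card ≃ P),
        RealRAM.ComputesWithin c A b (fun j => (p j : Fin d → ℝ))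
          (SepFamily (interior (closedPolyhedron A b)) (P : Set (Fin d → ℝ)))
          (C * (max P.card 1) ^ (d + 1))) := by
  obtain ⟨c, C, hc⟩ := RealRAM.exists_computesWithin_sepFamily d
  have hopen (l : ℕ) (A : Matrix (Fin l) (Fin d) ℝ) (b : Fin l → ℝ) (P : Finset (Fin d → ℝ))
      (p : Fin P.card ≃ P) : RealRAM.ComputesWithin c A b (fun j ↦ (p j : Fin d → ℝ))
        (SepFamily (openPolyhedron A b) P) (C * (max l 1 * max P.card 1) ^ (d + 1)) := by
    have hrange : Set.range (fun j ↦ (p j : Fin d → ℝ)) = P :=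
      (EquivLike.range_comp Subtype.val p).trans Subtype.range_coe
    exact hrange ▸ hc l P.card A b fun j ↦ p j
  have hfixed (l : ℕ) (A : Matrix (Fin l) (Fin d) ℝ) (b : Fin l → ℝ) : ∃ C : ℕ,
      ∀ (P : Finset (Fin d → ℝ)) (p : Fin P.card ≃ P),
        RealRAM.ComputesWithin c A b (fun j ↦ (p j : Fin d → ℝ))
          (SepFamily (openPolyhedron A b) P) (C * max P.card 1 ^ (d + 1)) :=
    ⟨C * max l 1 ^ (d + 1), fun P p ↦ by rw [mul_assoc, ← mul_pow]; exact hopen l A b P p⟩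
  refine ⟨c, ⟨C, hopen⟩, hfixed, fun l A b hA ↦ ?_⟩
  rw [interior_closedPolyhedron hA]
  exact hfixed l A b
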